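/- Let $K$ be an algebraically closed field of arbitrary characteristic. A (plane algebroid) curve $C:\{f=0\}$ is given by a nonzero power series $f\in K[[x,y]]$ without constant term, taken up to a unit; $m(C)=\mathrm{ord}\, f$ is its multiplicity, and its tangent cone is the zero set in $\mathbb P^1(K)$ of the initial form $\mathrm{in}\, f$. The curve is reduced if $f$ has no multiple factors, a branch if $f$ is irreducible, smooth if $m(C)=1$, singular if $m(C)>1$, and unitangent if its tangent cone is a single point. For branches $C:\{f=0\}$ and $D:\{g=0\}$ put $$d(C,D)=\frac{(C,D)_0}{m(C)\,m(D)}\in[0,+\infty],\qquad (C,D)_0=\dim_K K[[x,y]]/(f,g);$$ for reduced curves $C,D$ with irreducible components $C_i,D_j$ put $d(C,D)=\inf_{i,j} d(C_i,D_j)$. The contact exponent of a reduced curve $C$ is $d(C)=\sup\{d(C,W): W \text{ a smooth branch}\}$, and a smooth branch $W$ has maximal contact with $C$ if $d(C,W)=d(C)$. If $C:\{f=0\}$ is a unitangent curve of multiplicity $n$, its strict quadratic transform is $\widehat C:\{f_1=0\}$, where $f_1(x,y)=x^{-n}f(x,ax+xy)$ if $f=c(y-ax)^n+\cdots$ with $a,c\in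 K$, $c\neq 0$, and $f_1(x,y)=y^{-n}f(xy,y)$ if $f=cx^n+\cdots$ with $c\ne 0$ (dots stand for terms of higher order). **Theorem (Hironaka).** Let $C$ be a reduced singular unitangent curve and let $\widehat C$ be its strict quadratic transform. Then $\widehat C$ is a reduced curve, and: (i) if $d(C)<2$, then $m(\widehat C)<m(C)$; (ii) if $d(C)\ge 2$, then $m(\widehat C)=m(C)$ and $d(\widehat C)=d(C)-1$; (iii) if $d(C)\ge 2$ and $W$ is a smooth curve tangent to $C$ (that is, with the same tangent cone as $C$), then $d(C,W)=d(\widehat C,\widehat W)+1$; moreover, if $d(C)\geq 2$ and a smooth curve $W$ has maximal contact with $C$, then $\widehat W$ is smooth and has maximal contact with $\widehat C$. -/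

import Mathlib

open scoped ENNReal LinearAlgebra.Projectivization

noncomputable section

namespace PlaneCurve

/-- The ring `K[[x, y]]`; the variable `x` is `X 0` and `y` is `X 1`. -/
abbrev Series (K : Type*) := MvPowerSeries (Fin 2) K

variable {K : Type*} [Field K]

/-- `f` is an equation of a plane algebroid curve `{f = 0}`: a nonzero power series without
constant term. Equations that differ by a unit define the same curve; every notion below depends
on the equation up to a unit only. -/
def IsCurve (f : Series K) : Prop :=
  f ≠ 0 ∧ MvPowerSeries.constantCoeff f = 0

/-- The curve `{f = 0}` is reduced: `f` has no multiple factors. -/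
def IsReducedCurve (f : Series K) : Prop :=
  IsCurve f ∧ Squarefree f

/-- The multiplicity `m(C)` of `C = {f = 0}`: the order of `f`. -/
def mult (f : Series K) : ℕ∞ := f.order

/-- The initial form `∑_{i + j = n} c_{ij} x^i y^j` of `f = ∑ c_{ij} x^i y^j`, `n = ord f`. -/
def initialForm (f : Series K) : MvPolynomial (Fin 2) K :=
  ∑ i ∈ Finset.range (f.order.toNat + 1),
    MvPolynomial.monomial (Finsupp.single 0 i + Finsupp.single 1 (f.order.toNat - i))
      (MvPowerSeries.coeff (Finsupp.single 0 i + Finsupp.single 1 (f.order.toNat - i)) f)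

/-- The tangent cone of `{f = 0}`: the zeros of the initial form on the projective line. -/
def cone (f : Series K) : Set (ℙ K (Fin 2 → K)) :=
  {P | MvPolynomial.eval P.rep (initialForm f) = 0}

/-- The curve `{f = 0}` is unitangent: its tangent cone has exactly one point. -/
def IsUnitangent (f : Series K) : Prop :=
  (cone f).encard = 1

/-- A branch is a curve with irreducible equation; it is smooth if its multiplicity is one. -/
def IsSmoothBranch (w : Series K) : Prop :=
  Irreducible w ∧ mult w = 1

/-- The intersection number `(f, g)_0 = dim_K K[[x, y]] / (f, g)`, in `ℕ ∪ {∞}`. -/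
def interNum (f g : Series K) : ℕ∞ :=
  Cardinal.toENat (Module.rank K (Series K ⧸ Ideal.span ({f, g} : Set (Series K))))

/-- The order of contact of two branches: `(C, D)_0 / (m(C) m(D))`, in `[0, ∞]`. -/
def branchContact (p q : Series K) : ℝ≥0∞ :=
  (interNum p q : ℝ≥0∞) / ((mult p : ℝ≥0∞) * (mult q : ℝ≥0∞))

/-- `d(C, D)` for reduced curves: the infimum of the orders of contact of the irreducible
components of `C` with those of `D`. -/
def contact (f g : Series K) : ℝ≥0∞ :=
  ⨅ (p : Series K) (_ : Irreducible p ∧ p ∣ f) (q : Series K) (_ : Irreducible q ∧ q ∣ g),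
    branchContact p q

/-- The contact exponent `d(C)`: the supremum of `d(C, W)` over all smooth branches `W`. -/
def contactExponent (f : Series K) : ℝ≥0∞ :=
  ⨆ (w : Series K) (_ : IsSmoothBranch w), contact f w

/-- The smooth germ `{w = 0}` has maximal contact with the curve `{f = 0}`. -/
def HasMaximalContact (w f : Series K) : Prop :=
  IsSmoothBranch w ∧ contact f w = contactExponent f

/-- `z^{-n} g` for the variable `z = X i`, obtained by shifting the exponents of `z`
(for `g` divisible by `z^n`). -/
def divPow (i : Fin 2) (n : ℕ) (g : Series K) : Series K :=
  fun e => MvPowerSeries.coeff (e + Finsupp.single i n) g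

/-- `f = c (y - a x)^n + higher order terms` with `c ≠ 0`, where `n = ord f`. -/
def HasFiniteSlope (f : Series K) (a : K) : Prop :=
  ∃ c : K, c ≠ 0 ∧ initialForm f =
    MvPolynomial.C c *
      (MvPolynomial.X 1 - MvPolynomial.C a * MvPolynomial.X 0) ^ f.order.toNat

open Classical in
/-- The equation `f₁` of the strict quadratic transform of a unitangent curve `{f = 0}` of
multiplicity `n`: `x^{-n} f(x, a x + x y)` if `f = c (y - a x)^n + ⋯`, and `y^{-n} f(x y, y)`
otherwise (that is, if `f = c x^n + ⋯`). -/
def strictTransform (f : Series K) : Series K :=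
  if h : ∃ a : K, HasFiniteSlope f a then
    divPow 0 f.order.toNat
      (MvPowerSeries.subst
        ![(MvPowerSeries.X 0 : Series K),
          MvPowerSeries.C h.choose * MvPowerSeries.X 0 +
            MvPowerSeries.X 0 * MvPowerSeries.X 1] f)
  else
    divPow 1 f.order.toNat
      (MvPowerSeries.subst
        ![(MvPowerSeries.X 0 * MvPowerSeries.X 1 : Series K), MvPowerSeries.X 1] f)

end PlaneCurve

end

open scoped ENNReal LinearAlgebra.Projectivization

noncomputable section

namespace PlaneCurve

open MvPowerSeries (order constantCoeff)
open IsLocalRing (maximalIdeal)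

variable {K : Type*} [Field K]

/-! Intersection numbers, orders and contact exponents are invariant under automorphisms of
K[[x,y]], so a linear change of coordinates makes the tangent the line y = 0. This is `TanY`: the
series f₁(0,y) has order n = ord f, where f₁ = x^{-n} f(x,xy). By Weierstrass preparation f₁ is, up
to a unit, a distinguished polynomial P of degree n in y over K[[x]], and f is, up to a unit, P with
its roots multiplied by x (`contract`). A distinguished polynomial that divides another polynomial
in K[[x,y]] already divides it in K[[x]][y], so factorizations of f and of f₁ correspond:
squarefreeness, irreducibility and the list of branches pass to the transform.

Let p be a branch and w a smooth curve, both tangent to y = 0. Then w is a graph y = xφ(x), its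
transform is y = φ(x), and the polynomial with scaled roots takes at xφ the value x^n P(φ). Hence
(p,w) = ord p + (p₁,w₁) (`interNum_eq_add`). If ord p₁ = ord p, the contact drops by exactly one. If
ord p₁ < ord p, then p₁, being a branch over an algebraically closed field, has a single tangent
(`exists_hasTangent`), which must be x = 0, whereas w₁ is transversal to x = 0. So (p₁,w₁) ≤ ord p₁,
and d(p,w) ≤ 1 + ord p₁ / ord p < 2 with a bound independent of w (`exists_branchContact_le`).
Smooth curves not tangent to p have contact at most 1.

Consequently d(C) ≥ 2 forces every branch to keep its multiplicity, and if the multiplicity is kept,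
the line y = 0 already has contact at least 2 with all branches. The value of the new contact
exponent follows because a smooth curve not tangent to x = 0 is the transform of a smooth curve
tangent to C, while one tangent to x = 0 has contact at most 1 with the transform of C
(`contact_transform_add_one_le`). -/

/-! ### Coefficients and order in K[[x,y]] = K[[x]][[y]]. -/

/-- The variable `x` is sent to the inner, `y` to the outer variable of `K[[x]][[y]]`. -/
def finTwoEquiv : Fin 2 ≃ Option Unit where
  toFun i := if i = 0 then some () else none
  invFun o := if o = none then 1 else 0
  left_inv i := by fin_cases i <;> simp
  right_inv o := by rcases o with _ | _ <;> simp

/-- The identification `K[[x, y]] ≃ K[[x]][[y]]`. -/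
def iter : Series K ≃ₐ[K] PowerSeries (PowerSeries K) :=
  (MvPowerSeries.renameEquiv K finTwoEquiv).trans (MvPowerSeries.optionEquivLeft Unit K)

/-- The coefficient of `x^i y^j`. -/
def cf (f : Series K) (i j : ℕ) : K := PowerSeries.coeff i (PowerSeries.coeff j (iter f))

/-- Bridge to iterated series, where rescaling of y and Weierstrass preparation are available;
coefficients are handled through `cf` from here on. -/
theorem coeff_eq_cf (f : Series K) (d : Fin 2 →₀ ℕ) :
    MvPowerSeries.coeff d f = cf f (d 0) (d 1) := by
  have h : Finsupp.optionElim (d 1) (Finsupp.single () (d 0)) =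
      Finsupp.embDomain finTwoEquiv.toEmbedding d := by
    ext o
    rcases o with _ | ⟨⟩
    · rw [show (none : Option Unit) = finTwoEquiv.toEmbedding 1 from rfl,
        Finsupp.embDomain_apply_self]
      exact Finsupp.optionElim_apply_none _ _
    · rw [show (some () : Option Unit) = finTwoEquiv.toEmbedding 0 from rfl,
        Finsupp.embDomain_apply_self]
      exact (Finsupp.optionElim_apply_some _ _ _).trans (by simp)
  have h2 := MvPowerSeries.coeff_coeff_optionEquivLeft
    (MvPowerSeries.rename finTwoEquiv f) (d 1) (Finsupp.single () (d 0))
  rw [h] at h2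
  exact ((h2.trans (MvPowerSeries.coeff_embDomain_rename finTwoEquiv.toEmbedding f d))).symm

theorem cf_eq_coeff (f : Series K) (i j : ℕ) :
    cf f i j = MvPowerSeries.coeff (Finsupp.single 0 i + Finsupp.single 1 j) f := by
  rw [coeff_eq_cf]; simp

theorem ext_cf {f g : Series K} (h : ∀ i j, cf f i j = cf g i j) : f = g := by
  ext d; rw [coeff_eq_cf, coeff_eq_cf, h]

theorem degree_fin_two (d : Fin 2 →₀ ℕ) : d.degree = d 0 + d 1 := by
  simp [Finsupp.degree_eq_sum]

theorem le_order_iff {f : Series K} {n : ℕ} :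
    (n : ℕ∞) ≤ f.order ↔ ∀ i j, i + j < n → cf f i j = 0 := by
  constructor
  · intro h i j hij
    rw [cf_eq_coeff]
    apply MvPowerSeries.coeff_of_lt_order
    rw [degree_fin_two]
    refine lt_of_lt_of_le ?_ h
    simpa using mod_cast hij
  · intro h
    apply MvPowerSeries.nat_le_order
    intro d hd
    rw [coeff_eq_cf]
    exact h _ _ (by rwa [degree_fin_two] at hd)

theorem order_le_of_cf {f : Series K} {i j : ℕ} (h : cf f i j ≠ 0) : f.order ≤ (i + j : ℕ) := by
  by_contra hc
  have : ((i + j + 1 : ℕ) : ℕ∞) ≤ f.order := by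
    push_cast
    exact Order.add_one_le_of_lt (by simpa using hc)
  exact h (le_order_iff.1 this i j (by omega))

theorem iter_X_zero : iter (MvPowerSeries.X 0 : Series K) = PowerSeries.C PowerSeries.X := by
  have h : MvPowerSeries.rename finTwoEquiv (MvPowerSeries.X 0 : Series K) =
      MvPowerSeries.X (some ()) := MvPowerSeries.rename_X _ _
  exact (congrArg (MvPowerSeries.optionEquivLeft Unit K) h).trans
    (MvPowerSeries.optionEquivLeft_X_some ())

theorem iter_X_one : iter (MvPowerSeries.X 1 : Series K) = PowerSeries.X := by
  have h : MvPowerSeries.rename finTwoEquiv (MvPowerSeries.X 1 : Series K) =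
      MvPowerSeries.X none := MvPowerSeries.rename_X _ _
  exact (congrArg (MvPowerSeries.optionEquivLeft Unit K) h).trans
    MvPowerSeries.optionEquivLeft_X_none

theorem iter_C (c : K) : iter (MvPowerSeries.C c : Series K) = PowerSeries.C (PowerSeries.C c) := by
  have h : MvPowerSeries.rename finTwoEquiv (MvPowerSeries.C c : Series K) =
      MvPowerSeries.C c := MvPowerSeries.rename_C _ _
  exact (congrArg (MvPowerSeries.optionEquivLeft Unit K) h).trans
    (MvPowerSeries.optionEquivLeft_C c)

theorem cf_add (f g : Series K) (i j : ℕ) : cf (f + g) i j = cf f i j + cf g i j := by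
  simp [cf]

theorem cf_sub (f g : Series K) (i j : ℕ) : cf (f - g) i j = cf f i j - cf g i j := by
  simp [cf]

theorem cf_zero (i j : ℕ) : cf (0 : Series K) i j = 0 := by
  simp [cf]

theorem cf_zero_zero (f : Series K) : cf f 0 0 = constantCoeff f := by
  rw [cf_eq_coeff]; simp

theorem cf_C_mul (c : K) (f : Series K) (i j : ℕ) :
    cf (MvPowerSeries.C c * f) i j = c * cf f i j := by
  simp [cf, iter_C, ← PowerSeries.smul_eq_C_mul]

theorem cf_X_zero_pow_mul (n : ℕ) (f : Series K) (i j : ℕ) :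
    cf (MvPowerSeries.X 0 ^ n * f) i j = if n ≤ i then cf f (i - n) j else 0 := by
  rw [cf, map_mul, map_pow, iter_X_zero, ← map_pow, PowerSeries.coeff_C_mul,
    PowerSeries.coeff_X_pow_mul']
  rfl

theorem cf_X_one_pow_mul (n : ℕ) (f : Series K) (i j : ℕ) :
    cf (MvPowerSeries.X 1 ^ n * f) i j = if n ≤ j then cf f i (j - n) else 0 := by
  simp [cf, iter_X_one, PowerSeries.coeff_X_pow_mul']
  split_ifs <;> simp

theorem cf_one (i j : ℕ) : cf (1 : Series K) i j = if i = 0 ∧ j = 0 then 1 else 0 := by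
  simp only [cf, map_one, PowerSeries.coeff_one]
  split_ifs <;> simp_all [PowerSeries.coeff_one]

theorem cf_X_zero_pow (n : ℕ) (i j : ℕ) :
    cf (MvPowerSeries.X 0 ^ n : Series K) i j = if i = n ∧ j = 0 then 1 else 0 := by
  rw [← mul_one (MvPowerSeries.X 0 ^ n), cf_X_zero_pow_mul, cf_one]
  split_ifs <;> first | rfl | omega

theorem cf_X_one_pow (n : ℕ) (i j : ℕ) :
    cf (MvPowerSeries.X 1 ^ n : Series K) i j = if i = 0 ∧ j = n then 1 else 0 := by
  rw [← mul_one (MvPowerSeries.X 1 ^ n), cf_X_one_pow_mul, cf_one]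
  split_ifs <;> first | rfl | omega

/-! ### Order under ring homomorphisms. -/

/-- The part of `f` divisible by `x`, divided by `x`. -/
def quotX (f : Series K) : Series K :=
  iter.symm (PowerSeries.mk fun j => PowerSeries.mk fun i => cf f (i + 1) j)

/-- The `y`-part of `f`, divided by `y`. -/
def quotY (f : Series K) : Series K :=
  iter.symm (PowerSeries.mk fun j => PowerSeries.C (cf f 0 (j + 1)))

theorem cf_quotX (f : Series K) (i j : ℕ) : cf (quotX f) i j = cf f (i + 1) j := by
  simp [cf, quotX]

theorem cf_quotY (f : Series K) (i j : ℕ) :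
    cf (quotY f) i j = if i = 0 then cf f 0 (j + 1) else 0 := by
  simp only [quotY, cf, AlgEquiv.apply_symm_apply, PowerSeries.coeff_mk, PowerSeries.coeff_C]

theorem eq_X_mul_quotX_add {f : Series K} (h : cf f 0 0 = 0) :
    f = MvPowerSeries.X 0 * quotX f + MvPowerSeries.X 1 * quotY f := by
  apply ext_cf
  intro i j
  have h1 := cf_X_zero_pow_mul 1 (quotX f) i j
  have h2 := cf_X_one_pow_mul 1 (quotY f) i j
  rw [pow_one] at h1 h2
  rw [cf_add, h1, h2, cf_quotX, cf_quotY]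
  rcases i with _ | i <;> rcases j with _ | j <;> simp [h]

theorem le_order_quotX {f : Series K} {n : ℕ} (h : ((n + 1 : ℕ) : ℕ∞) ≤ f.order) :
    (n : ℕ∞) ≤ (quotX f).order := by
  rw [le_order_iff] at h ⊢
  intro i j hij
  rw [cf_quotX]
  exact h _ _ (by omega)

theorem le_order_quotY {f : Series K} {n : ℕ} (h : ((n + 1 : ℕ) : ℕ∞) ≤ f.order) :
    (n : ℕ∞) ≤ (quotY f).order := by
  rw [le_order_iff] at h ⊢
  intro i j hij
  rw [cf_quotY]
  split_ifs
  · exact h _ _ (by omega)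
  · rfl

/-- Induction along f = x·`quotX f` + y·`quotY f`, both quotients having order at least n. Only ring
operations are used, so θ need not be continuous. -/
theorem pow_dvd_map_of_le_order {S : Type*} [CommRing S] (θ : Series K →+* S) {t : S}
    (h0 : t ∣ θ (MvPowerSeries.X 0)) (h1 : t ∣ θ (MvPowerSeries.X 1)) {n : ℕ} :
    ∀ {f : Series K}, (n : ℕ∞) ≤ f.order → t ^ n ∣ θ f := by
  induction n with
  | zero => intro f _; simp
  | succ n ih =>
    intro f hf
    rw [eq_X_mul_quotX_add (le_order_iff.1 hf 0 0 (by omega)), map_add, map_mul, map_mul, pow_succ']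
    exact dvd_add (mul_dvd_mul h0 (ih (le_order_quotX hf)))
      (mul_dvd_mul h1 (ih (le_order_quotY hf)))

theorem le_order_map {θ : Series K →+* Series K}
    (h0 : constantCoeff (θ (MvPowerSeries.X 0)) = 0)
    (h1 : constantCoeff (θ (MvPowerSeries.X 1)) = 0) {n : ℕ} :
    ∀ {f : Series K}, (n : ℕ∞) ≤ f.order → (n : ℕ∞) ≤ (θ f).order := by
  rw [← MvPowerSeries.one_le_order_iff_constCoeff_eq_zero] at h0 h1
  induction n with
  | zero => intro f _; simp
  | succ n ih =>
    intro f hf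
    rw [eq_X_mul_quotX_add (le_order_iff.1 hf 0 0 (by omega)), map_add, map_mul, map_mul]
    refine le_trans (le_min ?_ ?_) MvPowerSeries.min_order_le_add
    · rw [MvPowerSeries.order_mul, add_comm n]
      push_cast
      exact add_le_add h0 (ih (le_order_quotX hf))
    · rw [MvPowerSeries.order_mul, add_comm n]
      push_cast
      exact add_le_add h1 (ih (le_order_quotY hf))

theorem order_eq_zero_iff_isUnit {f : Series K} : f.order = 0 ↔ IsUnit f := by
  rw [MvPowerSeries.isUnit_iff_constantCoeff, isUnit_iff_ne_zero, ← not_iff_not, ← ne_eq,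
    MvPowerSeries.order_ne_zero_iff_constCoeff_eq_zero, not_not]

theorem constantCoeff_map_equiv (σ : Series K ≃ₐ[K] Series K) {f : Series K}
    (hf : constantCoeff f = 0) : constantCoeff (σ f) = 0 := by
  rw [← MvPowerSeries.order_ne_zero_iff_constCoeff_eq_zero, ne_eq,
    order_eq_zero_iff_isUnit] at hf ⊢
  rwa [MulEquiv.isUnit_map]

/-- An automorphism preserves nonunits, so it sends the variables to series without constant term
and cannot lower the order; neither can its inverse. -/
theorem order_map_equiv (σ : Series K ≃ₐ[K] Series K) (f : Series K) :
    (σ f).order = f.order := by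
  have key : ∀ (σ : Series K ≃ₐ[K] Series K) (f : Series K), f.order ≤ (σ f).order := by
    intro σ f
    refine ENat.forall_natCast_le_iff_le.1 fun n hn => ?_
    exact le_order_map (θ := (σ : Series K →+* Series K))
      (constantCoeff_map_equiv σ (MvPowerSeries.constantCoeff_X _))
      (constantCoeff_map_equiv σ (MvPowerSeries.constantCoeff_X _)) hn
  refine le_antisymm ?_ (key σ f)
  simpa using key σ.symm (σ f)

theorem exists_order_eq {f : Series K} (hf : f ≠ 0) : ∃ n : ℕ, f.order = n :=
  ⟨_, (MvPowerSeries.ne_zero_iff_order_finite.1 hf).symm⟩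

theorem order_X_zero_pow (n : ℕ) : (MvPowerSeries.X 0 ^ n : Series K).order = n := by
  apply le_antisymm
  · have : cf (MvPowerSeries.X 0 ^ n : Series K) n 0 ≠ 0 := by simp [cf_X_zero_pow]
    simpa using order_le_of_cf this
  · rw [le_order_iff]
    intro i j hij
    rw [cf_X_zero_pow, if_neg (by omega)]

/-! ### The blow-up substitution and the strict transform in the chart (x, xy). -/

/-- The substitution `f(x, y) ↦ f(x, x y)`. -/
def blow : Series K →+* Series K :=
  ((iter (K := K)).symm : PowerSeries (PowerSeries K) →+* Series K).comp
    ((PowerSeries.rescale (PowerSeries.X : PowerSeries K)).comp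
      ((iter (K := K)) : Series K →+* PowerSeries (PowerSeries K)))

theorem iter_blow (f : Series K) : iter (blow f) = PowerSeries.rescale PowerSeries.X (iter f) := by
  simp [blow]

theorem cf_blow (f : Series K) (i j : ℕ) :
    cf (blow f) i j = if j ≤ i then cf f (i - j) j else 0 := by
  simp only [cf, iter_blow, PowerSeries.coeff_rescale, PowerSeries.coeff_X_pow_mul']

theorem blow_X_zero : blow (MvPowerSeries.X 0 : Series K) = MvPowerSeries.X 0 := by
  apply ext_cf
  intro i j
  have h := fun i j => cf_X_zero_pow (K := K) 1 i j
  simp only [pow_one] at h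
  rw [cf_blow, h, h]
  split_ifs <;> first | rfl | omega

theorem blow_X_one : blow (MvPowerSeries.X 1 : Series K) =
    MvPowerSeries.X 0 * MvPowerSeries.X 1 := by
  apply iter.injective
  rw [iter_blow, map_mul, iter_X_one, iter_X_zero, PowerSeries.rescale_X]

theorem blow_C (c : K) : blow (MvPowerSeries.C c : Series K) = MvPowerSeries.C c := by
  apply iter.injective
  rw [iter_blow, iter_C]
  ext j : 1
  rw [PowerSeries.coeff_rescale, PowerSeries.coeff_C]
  split_ifs with h
  · rw [h, pow_zero, one_mul]
  · rw [mul_zero]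

theorem hasSubst_of_fin_two {a b : Series K} (ha : constantCoeff a = 0)
    (hb : constantCoeff b = 0) : MvPowerSeries.HasSubst ![a, b] :=
  MvPowerSeries.hasSubst_of_constantCoeff_zero fun i => by fin_cases i <;> simpa

/-- The monomial x^a y^b goes to x^{a+b} y^b, so each coefficient of the result comes from at most
one monomial of f. -/
theorem subst_eq_blow (f : Series K) :
    MvPowerSeries.subst ![(MvPowerSeries.X 0 : Series K),
      MvPowerSeries.X 0 * MvPowerSeries.X 1] f = blow f := by
  have hs : MvPowerSeries.HasSubst ![(MvPowerSeries.X 0 : Series K),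
      MvPowerSeries.X 0 * MvPowerSeries.X 1] := hasSubst_of_fin_two (by simp) (by simp)
  have hm : ∀ d : Fin 2 →₀ ℕ, ∀ i j, cf (d.prod fun s n => (![(MvPowerSeries.X 0 : Series K),
      MvPowerSeries.X 0 * MvPowerSeries.X 1] s) ^ n) i j =
        if d 0 + d 1 = i ∧ d 1 = j then 1 else 0 := by
    intro d i j
    rw [Finsupp.prod_fintype _ _ (by simp), Fin.prod_univ_two]
    simp only [Matrix.cons_val_zero, Matrix.cons_val_one]
    rw [mul_pow, ← mul_assoc, ← pow_add, cf_X_zero_pow_mul, cf_X_one_pow]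
    split_ifs <;> first | rfl | omega
  apply ext_cf
  intro i j
  rw [cf_eq_coeff, MvPowerSeries.coeff_subst hs, cf_blow]
  have hc : ∀ d : Fin 2 →₀ ℕ, MvPowerSeries.coeff d f •
      MvPowerSeries.coeff (Finsupp.single 0 i + Finsupp.single 1 j)
        (d.prod fun s n => (![(MvPowerSeries.X 0 : Series K),
          MvPowerSeries.X 0 * MvPowerSeries.X 1] s) ^ n) =
      cf f (d 0) (d 1) * if d 0 + d 1 = i ∧ d 1 = j then 1 else 0 := by
    intro d
    rw [coeff_eq_cf f, ← cf_eq_coeff, hm, smul_eq_mul]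
  rw [finsum_congr hc, finsum_eq_single _ (Finsupp.single 0 (i - j) + Finsupp.single 1 j)]
  · simp only [Finsupp.add_apply, Finsupp.single_apply]
    simp
    congr 1
    exact propext (by omega)
  · intro d hd
    rw [if_neg, mul_zero]
    rintro ⟨h1, h2⟩
    apply hd
    ext k
    fin_cases k <;> simp <;> omega

/-- The strict transform `x^{-n} f(x, x y)`, where `n` is the order of `f`. -/
def transform (f : Series K) : Series K := divPow 0 f.order.toNat (blow f)

theorem cf_divPow_zero (n : ℕ) (f : Series K) (i j : ℕ) :
    cf (divPow 0 n f) i j = cf f (i + n) j := by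
  rw [cf_eq_coeff, cf_eq_coeff]
  change MvPowerSeries.coeff _ f = _
  congr 2
  ext k
  fin_cases k <;> simp

theorem cf_transform {f : Series K} {n : ℕ} (hf : f.order = n) (i j : ℕ) :
    cf (transform f) i j = if j ≤ i + n then cf f (i + n - j) j else 0 := by
  rw [transform, hf, ENat.toNat_natCast, cf_divPow_zero, cf_blow]

theorem X_pow_mul_transform {f : Series K} {n : ℕ} (hf : f.order = n) :
    MvPowerSeries.X 0 ^ n * transform f = blow f := by
  apply ext_cf
  intro i j
  rw [cf_X_zero_pow_mul, cf_transform hf, cf_blow]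
  split_ifs with h1 h2 h3 h4
  · congr 1; omega
  · omega
  · omega
  · rfl
  · exact (le_order_iff.1 hf.ge _ _ (by omega)).symm
  · rfl

theorem X_zero_ne_zero : (MvPowerSeries.X 0 : Series K) ≠ 0 := by
  intro h
  have := cf_X_zero_pow (K := K) 1 1 0
  simp [h, cf_zero] at this

theorem X_zero_pow_ne_zero (n : ℕ) : (MvPowerSeries.X 0 : Series K) ^ n ≠ 0 :=
  pow_ne_zero _ X_zero_ne_zero

theorem transform_eq_of_X_pow_mul {f g : Series K} {n : ℕ} (hf : f.order = n)
    (h : MvPowerSeries.X 0 ^ n * g = blow f) : transform f = g :=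
  mul_left_cancel₀ (X_zero_pow_ne_zero n) ((X_pow_mul_transform hf).trans h.symm)

/-- Orders add and `blow` is multiplicative, so the powers of x taken out match. -/
theorem transform_mul {f g : Series K} (hf : f ≠ 0) (hg : g ≠ 0) :
    transform (f * g) = transform f * transform g := by
  obtain ⟨n, hn⟩ := exists_order_eq hf
  obtain ⟨m, hm⟩ := exists_order_eq hg
  apply transform_eq_of_X_pow_mul (n := n + m)
  · rw [MvPowerSeries.order_mul, hn, hm]; norm_cast
  · rw [map_mul, ← X_pow_mul_transform hn, ← X_pow_mul_transform hm]
    ring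

theorem transform_eq_blow {f : Series K} (hf : IsUnit f) : transform f = blow f :=
  transform_eq_of_X_pow_mul (n := 0) (by simpa using order_eq_zero_iff_isUnit.2 hf) (by simp)

theorem isUnit_transform {f : Series K} (hf : IsUnit f) : IsUnit (transform f) := by
  rw [transform_eq_blow hf]
  exact hf.map _

theorem associated_transform {f g : Series K} (hf : f ≠ 0) (h : Associated f g) :
    Associated (transform f) (transform g) := by
  obtain ⟨u, rfl⟩ := h
  rw [transform_mul hf u.ne_zero]
  exact ⟨(isUnit_transform u.isUnit).unit, rfl⟩

theorem blow_injective : Function.Injective (blow (K := K)) := by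
  intro f g h
  apply ext_cf
  intro i j
  have h1 := cf_blow f (i + j) j
  rw [h, cf_blow] at h1
  simpa using h1.symm

theorem transform_ne_zero {f : Series K} (hf : f ≠ 0) : transform f ≠ 0 := by
  obtain ⟨n, hn⟩ := exists_order_eq hf
  intro h
  have h1 := X_pow_mul_transform hn
  rw [h, mul_zero] at h1
  exact hf (blow_injective (by rw [← h1, map_zero]))

/-! ### The order of f(0,y) and tangency to y = 0. -/

/-- The restriction `f(0, y)`. -/
def restr : Series K →+* PowerSeries K :=
  (PowerSeries.map PowerSeries.constantCoeff).comp
    ((iter (K := K)) : Series K →+* PowerSeries (PowerSeries K))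

theorem coeff_restr (f : Series K) (j : ℕ) : PowerSeries.coeff j (restr f) = cf f 0 j := by
  simp [restr, cf]

/-- The order of `f(0, y)`. -/
def ordY (f : Series K) : ℕ∞ := (restr f).order

theorem ordY_mul (f g : Series K) : ordY (f * g) = ordY f + ordY g := by
  rw [ordY, map_mul, PowerSeries.order_mul]; rfl

theorem ordY_le_of_cf {f : Series K} {j : ℕ} (h : cf f 0 j ≠ 0) : ordY f ≤ j :=
  PowerSeries.order_le _ (by rwa [coeff_restr])

theorem le_ordY_iff {f : Series K} {n : ℕ} : (n : ℕ∞) ≤ ordY f ↔ ∀ j < n, cf f 0 j = 0 := by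
  constructor
  · intro h j hj
    rw [← coeff_restr]
    exact PowerSeries.coeff_of_lt_order _ (lt_of_lt_of_le (by exact_mod_cast hj) h)
  · intro h
    exact PowerSeries.nat_le_order _ _ fun j hj => by rw [coeff_restr]; exact h j hj

theorem ordY_eq_iff {f : Series K} {n : ℕ} :
    ordY f = n ↔ cf f 0 n ≠ 0 ∧ ∀ j < n, cf f 0 j = 0 := by
  constructor
  · intro h
    refine ⟨?_, le_ordY_iff.1 h.ge⟩
    intro h0
    have : ((n + 1 : ℕ) : ℕ∞) ≤ ordY f := by
      rw [le_ordY_iff]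
      intro j hj
      rcases Nat.lt_succ_iff_lt_or_eq.1 hj with hj | rfl
      · exact le_ordY_iff.1 h.ge j hj
      · exact h0
    rw [h] at this
    exact absurd (Nat.cast_le.1 this) (by omega)
  · rintro ⟨h1, h2⟩
    exact le_antisymm (ordY_le_of_cf h1) (le_ordY_iff.2 h2)

theorem order_le_ordY (f : Series K) : f.order ≤ ordY f := by
  refine ENat.forall_natCast_le_iff_le.1 fun n hn => ?_
  rw [le_ordY_iff]
  intro j hj
  exact le_order_iff.1 hn _ _ (by omega)

theorem ordY_eq_zero_iff_isUnit {f : Series K} : ordY f = 0 ↔ IsUnit f := by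
  rw [MvPowerSeries.isUnit_iff_constantCoeff, isUnit_iff_ne_zero, ← cf_zero_zero]
  have := ordY_eq_iff (f := f) (n := 0)
  simpa using this

theorem ordY_eq_of_associated {f g : Series K} (h : Associated f g) : ordY f = ordY g := by
  obtain ⟨u, rfl⟩ := h
  rw [ordY_mul, ordY_eq_zero_iff_isUnit.2 u.isUnit, add_zero]

theorem order_eq_of_associated {f g : Series K} (h : Associated f g) : f.order = g.order := by
  obtain ⟨u, rfl⟩ := h
  rw [MvPowerSeries.order_mul, order_eq_zero_iff_isUnit.2 u.isUnit, add_zero]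

/-- The coefficients of y^j, j ≤ n, in f₁(0,y) are those of the initial form of f at (1,y). If all
of them vanished, so would the initial form. -/
theorem ordY_transform_le {f : Series K} (hf : f ≠ 0) : ordY (transform f) ≤ f.order := by
  obtain ⟨n, hn⟩ := exists_order_eq hf
  by_contra hc
  have h1 : ((n + 1 : ℕ) : ℕ∞) ≤ ordY (transform f) := by
    push_cast
    exact Order.add_one_le_of_lt (by simpa [hn] using hc)
  have h2 : ((n + 1 : ℕ) : ℕ∞) ≤ f.order := by
    rw [le_order_iff]
    intro i j hij
    rcases Nat.lt_succ_iff_lt_or_eq.1 hij with h | h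
    · exact le_order_iff.1 hn.ge _ _ h
    · have h3 := le_ordY_iff.1 h1 j (by omega)
      rw [cf_transform hn, if_pos (by omega)] at h3
      rwa [show 0 + n - j = i by omega] at h3
  rw [hn] at h2
  exact absurd (Nat.cast_le.1 h2) (by omega)

/-- The curve `{f = 0}` is unitangent with tangent `y = 0`. -/
def TanY (f : Series K) : Prop := f ≠ 0 ∧ ordY (transform f) = f.order

/-- Both orders are additive and `ordY_transform_le` holds for each factor, so equality for the
product forces equality for the factors. -/
theorem TanY.of_mul {f g : Series K} (h : TanY (f * g)) : TanY f ∧ TanY g := by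
  have hf : f ≠ 0 := left_ne_zero_of_mul h.1
  have hg : g ≠ 0 := right_ne_zero_of_mul h.1
  obtain ⟨n, hn⟩ := exists_order_eq hf
  obtain ⟨m, hm⟩ := exists_order_eq hg
  have h1 := h.2
  rw [transform_mul hf hg, ordY_mul, MvPowerSeries.order_mul] at h1
  have h2 := ordY_transform_le hf
  have h3 := ordY_transform_le hg
  refine ⟨⟨hf, ?_⟩, ⟨hg, ?_⟩⟩
  all_goals
    rw [hn] at *
    rw [hm] at *
    lift ordY (transform f) to ℕ using ne_top_of_le_ne_top (ENat.natCast_ne_top _) h2 with a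
    lift ordY (transform g) to ℕ using ne_top_of_le_ne_top (ENat.natCast_ne_top _) h3 with b
    norm_cast at *
    omega

theorem TanY.of_dvd {f g : Series K} (h : TanY f) (hd : g ∣ f) : TanY g := by
  obtain ⟨k, rfl⟩ := hd
  exact h.of_mul.1

theorem tanY_iff_cf {f : Series K} {n : ℕ} (hn : f.order = n) :
    TanY f ↔ cf f 0 n ≠ 0 ∧ ∀ i j, i + j = n → 0 < i → cf f i j = 0 := by
  have hf : f ≠ 0 := by
    rintro rfl
    simp at hn
  rw [TanY, hn, ordY_eq_iff, cf_transform hn]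
  simp only [hf, ne_eq, not_false_eq_true, true_and, zero_add, le_refl, if_true, Nat.sub_self]
  refine and_congr_right fun _ => ⟨fun h i j hij hi => ?_, fun h j hj => ?_⟩
  · have := h j (by omega)
    rwa [cf_transform hn, if_pos (by omega), show 0 + n - j = i by omega] at this
  · rw [cf_transform hn, if_pos (by omega)]
    exact h _ _ (by omega) (by omega)

theorem TanY.ordY_eq {f : Series K} (h : TanY f) : ordY f = f.order := by
  obtain ⟨n, hn⟩ := exists_order_eq h.1
  refine le_antisymm ?_ (order_le_ordY f)
  rw [hn]
  exact ordY_le_of_cf ((tanY_iff_cf hn).1 h).1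

/-- `f = c ℓ^n + ⋯` with `c ≠ 0`, where `n` is the order of `f`. -/
def HasTangent (f ℓ : Series K) : Prop :=
  ∃ n : ℕ, f.order = n ∧ ∃ c : K, c ≠ 0 ∧
    ((n + 1 : ℕ) : ℕ∞) ≤ (f - MvPowerSeries.C c * ℓ ^ n).order

theorem hasTangent_iff_tanY {f : Series K} : HasTangent f (MvPowerSeries.X 1) ↔ TanY f := by
  constructor
  · rintro ⟨n, hn, c, hc, h⟩
    rw [le_order_iff] at h
    rw [tanY_iff_cf hn]
    constructor
    · have := h 0 n (by omega)
      rw [cf_sub, cf_C_mul, cf_X_one_pow] at this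
      simp at this
      rw [sub_eq_zero] at this
      rwa [this]
    · intro i j hij hi
      have := h i j (by omega)
      rw [cf_sub, cf_C_mul, cf_X_one_pow, if_neg (by omega)] at this
      simpa using this
  · intro h
    obtain ⟨n, hn⟩ := exists_order_eq h.1
    have h1 := (tanY_iff_cf hn).1 h
    refine ⟨n, hn, cf f 0 n, h1.1, ?_⟩
    rw [le_order_iff]
    intro i j hij
    rw [cf_sub, cf_C_mul, cf_X_one_pow]
    rcases Nat.lt_succ_iff_lt_or_eq.1 hij with hh | hh
    · rw [if_neg (by omega), le_order_iff.1 hn.ge _ _ hh]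
      simp
    · rcases Nat.eq_zero_or_pos i with rfl | hi
      · rw [if_pos (by omega)]
        simp [← hh]
      · rw [if_neg (by omega), h1.2 i j hh hi]
        simp

/-- Tangency is expressed by the order of a remainder precisely so that it is carried along by every
automorphism. -/
theorem HasTangent.map {f ℓ : Series K} (σ : Series K ≃ₐ[K] Series K) (h : HasTangent f ℓ) :
    HasTangent (σ f) (σ ℓ) := by
  obtain ⟨n, hn, c, hc, h⟩ := h
  refine ⟨n, by rw [order_map_equiv, hn], c, hc, ?_⟩
  rw [← order_map_equiv σ, map_sub, map_mul, map_pow] at h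
  have : σ (MvPowerSeries.C c) = MvPowerSeries.C c := σ.commutes c
  rwa [this] at h

/-! ### Weierstrass preparation and contraction. -/

theorem mem_maximalIdeal_iff {a : PowerSeries K} :
    a ∈ maximalIdeal (PowerSeries K) ↔ PowerSeries.coeff 0 a = 0 := by
  rw [PowerSeries.coeff_zero_eq_constantCoeff_apply, IsLocalRing.mem_maximalIdeal, mem_nonunits_iff, PowerSeries.isUnit_iff_constantCoeff,
    isUnit_iff_ne_zero, not_not]

instance isAdicComplete_powerSeries :
    IsAdicComplete (maximalIdeal (PowerSeries K)) (PowerSeries K) := by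
  rw [PowerSeries.maximalIdeal_eq_span_X]
  infer_instance

/-- A polynomial in `y` over `K[[x]]` as a power series in `x` and `y`. -/
def ofPoly : Polynomial (PowerSeries K) →+* Series K :=
  ((iter (K := K)).symm : PowerSeries (PowerSeries K) →+* Series K).comp
    Polynomial.coeToPowerSeries.ringHom

theorem iter_ofPoly (P : Polynomial (PowerSeries K)) :
    iter (ofPoly P) = (P : PowerSeries (PowerSeries K)) := by
  simp [ofPoly]

theorem cf_ofPoly (P : Polynomial (PowerSeries K)) (i j : ℕ) :
    cf (ofPoly P) i j = PowerSeries.coeff i (P.coeff j) := by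
  rw [cf, iter_ofPoly, Polynomial.coeff_coe]

theorem ofPoly_C_X : ofPoly (Polynomial.C PowerSeries.X) = (MvPowerSeries.X 0 : Series K) := by
  apply iter.injective
  rw [iter_ofPoly, iter_X_zero, Polynomial.coe_C]

theorem ofPoly_X : ofPoly Polynomial.X = (MvPowerSeries.X 1 : Series K) := by
  apply iter.injective
  rw [iter_ofPoly, iter_X_one, Polynomial.coe_X]

/-- Distinguished polynomials in `y` over `K[[x]]`. -/
abbrev Distinguished (P : Polynomial (PowerSeries K)) : Prop :=
  P.IsDistinguishedAt (maximalIdeal (PowerSeries K))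

theorem Distinguished.ordY_ofPoly {P : Polynomial (PowerSeries K)} (h : Distinguished P) :
    ordY (ofPoly P) = P.natDegree := by
  rw [ordY_eq_iff]
  constructor
  · rw [cf_ofPoly, h.monic.coeff_natDegree]
    simp
  · intro j hj
    rw [cf_ofPoly]
    exact mem_maximalIdeal_iff.1 (h.mem hj)

theorem distinguished_of_ordY {P : Polynomial (PowerSeries K)} (hP : P.Monic)
    (h : ordY (ofPoly P) = P.natDegree) : Distinguished P := by
  refine ⟨⟨fun {j} hj => ?_⟩, hP⟩
  rw [mem_maximalIdeal_iff]
  have := (ordY_eq_iff.1 h).2 j hj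
  rwa [cf_ofPoly] at this

/-- Weierstrass preparation. -/
theorem exists_distinguished {f : Series K} {n : ℕ} (hf : ordY f = n) :
    ∃ P : Polynomial (PowerSeries K), Distinguished P ∧ P.natDegree = n ∧
      Associated f (ofPoly P) := by
  have h0 : (iter f).map (IsLocalRing.residue (PowerSeries K)) ≠ 0 := by
    intro h
    have h1 := congrArg (PowerSeries.coeff n) h
    rw [PowerSeries.coeff_map, map_zero, IsLocalRing.residue_eq_zero_iff,
      mem_maximalIdeal_iff] at h1
    exact (ordY_eq_iff.1 hf).1 h1
  obtain ⟨P, u, hP, hu, he⟩ := PowerSeries.exists_isWeierstrassFactorization h0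
  have ha : Associated f (ofPoly P) := by
    apply Associated.symm
    refine ⟨(hu.map iter.symm).unit, ?_⟩
    apply iter.injective
    rw [map_mul, iter_ofPoly, he]
    simp
  refine ⟨P, hP, ?_, ha⟩
  have h2 := Distinguished.ordY_ofPoly hP
  rw [← ordY_eq_of_associated ha, hf] at h2
  exact_mod_cast h2.symm

/-- Weierstrass division makes A[y]/(G) → A[[y]]/(G) an isomorphism; its injectivity is the claim.
-/
theorem dvd_of_coe_dvd {A : Type*} [CommRing A] {I : Ideal A} [IsAdicComplete I A]
    {G P : Polynomial A} (hG : G.IsDistinguishedAt I)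
    (h : (G : PowerSeries A) ∣ (P : PowerSeries A)) : G ∣ P := by
  have h2 := hG.algEquivQuotient.injective (a₁ := Ideal.Quotient.mk _ P) (a₂ := 0) (by
    rw [map_zero]
    change Ideal.Quotient.mk _ (Polynomial.coeToPowerSeries.algHom _ P) = 0
    rw [Ideal.Quotient.eq_zero_iff_mem, Ideal.mem_span_singleton]
    simpa using h)
  rwa [Ideal.Quotient.eq_zero_iff_mem, Ideal.mem_span_singleton] at h2

theorem Distinguished.dvd_of_ofPoly_dvd {G P : Polynomial (PowerSeries K)} (hG : Distinguished G)
    (h : ofPoly G ∣ ofPoly P) : G ∣ P := by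
  have h1 : (G : PowerSeries (PowerSeries K)) ∣ (P : PowerSeries (PowerSeries K)) := by
    rw [← iter_ofPoly, ← iter_ofPoly]
    exact map_dvd iter h
  exact dvd_of_coe_dvd hG h1

/-- The inverse of the strict transform on distinguished polynomials. -/
def contract (P : Polynomial (PowerSeries K)) : Series K := ofPoly (P.scaleRoots PowerSeries.X)

theorem cf_contract (P : Polynomial (PowerSeries K)) (i j : ℕ) :
    cf (contract P) i j = if P.natDegree - j ≤ i then
      PowerSeries.coeff (i - (P.natDegree - j)) (P.coeff j) else 0 := by
  rw [contract, cf_ofPoly, Polynomial.coeff_scaleRoots, PowerSeries.coeff_mul_X_pow']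

theorem contract_mul (P Q : Polynomial (PowerSeries K)) :
    contract (P * Q) = contract P * contract Q := by
  rw [contract, Polynomial.mul_scaleRoots_of_noZeroDivisors, map_mul]; rfl

theorem blow_contract (P : Polynomial (PowerSeries K)) :
    blow (contract P) = MvPowerSeries.X 0 ^ P.natDegree * ofPoly P := by
  apply ext_cf
  intro i j
  rw [cf_blow, cf_contract, cf_X_zero_pow_mul, cf_ofPoly]
  rcases le_or_gt j P.natDegree with h | h
  · split_ifs
    · congr 2; omega
    all_goals first | rfl | omega
  · rw [Polynomial.coeff_eq_zero_of_natDegree_lt h]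
    simp

theorem order_contract {P : Polynomial (PowerSeries K)} (hP : P.Monic) :
    (contract P).order = P.natDegree := by
  apply le_antisymm
  · have : cf (contract P) 0 P.natDegree ≠ 0 := by
      rw [cf_contract]
      simp [hP.coeff_natDegree]
    simpa using order_le_of_cf this
  · rw [le_order_iff]
    intro i j hij
    rw [cf_contract, if_neg (by omega)]

theorem ne_zero_of_order_eq {f : Series K} {n : ℕ} (h : f.order = n) : f ≠ 0 := by
  rintro rfl
  simp at h

theorem transform_contract {P : Polynomial (PowerSeries K)} (hP : P.Monic) :
    transform (contract P) = ofPoly P :=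
  transform_eq_of_X_pow_mul (order_contract hP) (blow_contract P).symm

theorem Distinguished.tanY_contract {P : Polynomial (PowerSeries K)} (hP : Distinguished P) :
    TanY (contract P) := by
  refine ⟨ne_zero_of_order_eq (order_contract hP.monic), ?_⟩
  rw [transform_contract hP.monic, order_contract hP.monic, hP.ordY_ofPoly]

/-- Weierstrass preparation for a power series of order `n` containing the monomial `y^n`. -/
theorem exists_contract {f : Series K} {n : ℕ} (hf : ordY f = n) (ho : f.order = n) :
    ∃ P : Polynomial (PowerSeries K), P.Monic ∧ P.natDegree = n ∧ Associated f (contract P) := by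
  obtain ⟨Q, hQ, hn, ha⟩ := exists_distinguished hf
  -- Order n makes x^{n-j} divide the coefficient of y^j, which says that Q arises from some P by
  -- multiplying the roots by x.
  have h1 : ∀ j, j ≤ n → PowerSeries.X ^ (n - j) ∣ Q.coeff j := by
    intro j hj
    rw [PowerSeries.X_pow_dvd_iff]
    intro i hi
    rw [← cf_ofPoly]
    rw [order_eq_of_associated ha] at ho
    exact le_order_iff.1 ho.ge _ _ (by omega)
  choose! a ha' using h1
  have hmon : Q.coeff n = 1 := by rw [← hn]; exact hQ.monic.coeff_natDegree
  have han : a n = 1 := by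
    have := ha' n le_rfl
    rw [hmon] at this
    simpa using this.symm
  let P : Polynomial (PowerSeries K) :=
    ∑ j ∈ Finset.range (n + 1), Polynomial.monomial j (a j)
  have hc : ∀ j, P.coeff j = if j ≤ n then a j else 0 := by
    intro j
    simp [P, Polynomial.coeff_monomial]
  have hle : P.natDegree ≤ n := by
    rw [Polynomial.natDegree_le_iff_coeff_eq_zero]
    intro j hj
    rw [hc, if_neg (by omega)]
  have hP : P.Monic := Polynomial.monic_of_natDegree_le_of_coeff_eq_one n hle (by simp [hc, han])
  have hd : P.natDegree = n := by
    refine le_antisymm hle (Polynomial.le_natDegree_of_ne_zero ?_)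
    simp [hc, han]
  refine ⟨P, hP, hd, ?_⟩
  have : P.scaleRoots PowerSeries.X = Q := by
    ext1 j
    rw [Polynomial.coeff_scaleRoots, hd, hc]
    split_ifs with h
    · rw [ha' j h, mul_comm]
    · rw [zero_mul, Polynomial.coeff_eq_zero_of_natDegree_lt (by omega)]
  rwa [contract, this]

theorem TanY.exists_contract {f : Series K} (h : TanY f) :
    ∃ P : Polynomial (PowerSeries K), Distinguished P ∧ Associated f (contract P) ∧
      Associated (transform f) (ofPoly P) := by
  obtain ⟨n, hn⟩ := exists_order_eq h.1
  obtain ⟨P, hP, hd, ha⟩ := PlaneCurve.exists_contract (h.ordY_eq.trans hn) hn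
  have hT := associated_transform h.1 ha
  rw [transform_contract hP] at hT
  refine ⟨P, distinguished_of_ordY hP ?_, ha, hT⟩
  rw [← ordY_eq_of_associated hT, h.2, hn, hd]

/-! ### Correspondence between the factors of a curve and of its transform. -/

theorem TanY.isUnit_of_transform {f : Series K} (h : TanY f) (hu : IsUnit (transform f)) :
    IsUnit f := by
  rw [← ordY_eq_zero_iff_isUnit, h.2] at hu
  exact order_eq_zero_iff_isUnit.1 hu

/-- Divisors descend: the cofactor of a distinguished divisor is again a polynomial, and contraction
is multiplicative. -/
theorem contract_dvd {f : Series K} {P Q : Polynomial (PowerSeries K)} (hQ : Distinguished Q)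
    (ha : Associated f (contract P)) (h : ofPoly Q ∣ ofPoly P) : contract Q ∣ f := by
  obtain ⟨R, rfl⟩ := hQ.dvd_of_ofPoly_dvd h
  rw [contract_mul] at ha
  exact (Dvd.intro _ rfl).trans ha.symm.dvd

theorem TanY.exists_of_dvd_transform {f q : Series K} (h : TanY f) (hq : q ∣ transform f) :
    ∃ Q : Polynomial (PowerSeries K), Distinguished Q ∧ Associated q (ofPoly Q) := by
  obtain ⟨n, hn⟩ := exists_order_eq h.1
  obtain ⟨k, hk⟩ := hq
  have h1 := h.2
  rw [hk, ordY_mul, hn] at h1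
  have h2 : ordY q ≠ ⊤ := by
    intro h3
    rw [h3, top_add] at h1
    exact ENat.top_ne_natCast _ h1
  lift ordY q to ℕ using h2 with m hm
  obtain ⟨Q, hQ, -, ha⟩ := exists_distinguished hm.symm
  exact ⟨Q, hQ, ha⟩

theorem TanY.transform_dvd {f g : Series K} (h : TanY f) (hg : g ∣ f) :
    transform g ∣ transform f := by
  obtain ⟨k, rfl⟩ := hg
  rw [transform_mul (left_ne_zero_of_mul h.1) (right_ne_zero_of_mul h.1)]
  exact Dvd.intro _ rfl

theorem TanY.irreducible_transform {f : Series K} (h : TanY f) (hf : Irreducible f) :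
    Irreducible (transform f) := by
  refine ⟨fun hu => hf.not_isUnit (h.isUnit_of_transform hu), ?_⟩
  intro a b hab
  obtain ⟨P, hP, hfP, hTP⟩ := h.exists_contract
  obtain ⟨Q, hQ, haQ⟩ := h.exists_of_dvd_transform (Dvd.intro b hab.symm)
  have hd : contract Q ∣ f := contract_dvd hQ hfP
    (haQ.symm.dvd.trans ((Dvd.intro b hab.symm).trans hTP.dvd))
  obtain ⟨k, hk⟩ := hd
  rcases hf.isUnit_or_isUnit hk with hu | hu
  · left
    have := isUnit_transform hu
    rw [transform_contract hQ.monic] at this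
    exact haQ.symm.isUnit this
  · right
    have h1 : Associated (transform f) (ofPoly Q) := by
      rw [← transform_contract hQ.monic]
      refine associated_transform h.1 ?_
      rw [hk]
      exact associated_mul_unit_left _ _ hu
    have h2 : Associated (a * b) (a * 1) := by
      rw [← hab, mul_one]
      exact h1.trans haQ.symm
    have ha0 : a ≠ 0 := by
      rintro rfl
      rw [zero_mul] at hab
      exact transform_ne_zero h.1 hab
    exact (Associated.of_mul_left h2 (Associated.refl a) ha0).symm.isUnit isUnit_one

theorem TanY.squarefree_transform {f : Series K} (h : TanY f) (hf : Squarefree f) :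
    Squarefree (transform f) := by
  intro x hx
  obtain ⟨P, hP, hfP, hTP⟩ := h.exists_contract
  obtain ⟨Q, hQ, haQ⟩ := h.exists_of_dvd_transform ((Dvd.intro x rfl).trans hx)
  have hd : contract (Q * Q) ∣ f := by
    refine contract_dvd (hQ.mul hQ) hfP ?_
    rw [map_mul]
    exact ((haQ.mul_mul haQ).symm.dvd.trans hx).trans hTP.dvd
  rw [contract_mul] at hd
  have := isUnit_transform (hf _ hd)
  rw [transform_contract hQ.monic] at this
  exact haQ.symm.isUnit this

/-- The branch sought is the contraction of the Weierstrass polynomial of q. A factorization of it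
would transform into one of q, and a factor whose transform is a unit is itself a unit. -/
theorem TanY.exists_irreducible_of_dvd_transform {f q : Series K} (h : TanY f)
    (hq : Irreducible q) (hd : q ∣ transform f) :
    ∃ p, Irreducible p ∧ p ∣ f ∧ Associated (transform p) q := by
  obtain ⟨P, hP, hfP, hTP⟩ := h.exists_contract
  obtain ⟨Q, hQ, haQ⟩ := h.exists_of_dvd_transform hd
  have hdvd : contract Q ∣ f := contract_dvd hQ hfP (haQ.symm.dvd.trans (hd.trans hTP.dvd))
  have hT : Associated (transform (contract Q)) q := by
    rw [transform_contract hQ.monic]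
    exact haQ.symm
  refine ⟨contract Q, ⟨fun hu => hq.not_isUnit (hT.isUnit (isUnit_transform hu)), ?_⟩, hdvd, hT⟩
  intro a b hab
  have hab' := hQ.tanY_contract
  rw [hab] at hab' hT
  rw [transform_mul (left_ne_zero_of_mul hab'.1) (right_ne_zero_of_mul hab'.1)] at hT
  rcases (hT.symm.irreducible hq).isUnit_or_isUnit rfl with hu | hu
  · exact Or.inl (hab'.of_mul.1.isUnit_of_transform hu)
  · exact Or.inr (hab'.of_mul.2.isUnit_of_transform hu)

/-! ### Homogeneous parts and linear changes of coordinates. -/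

/-- The value at `(α, β)` of the homogeneous part of degree `m` of `f`. -/
def form (f : Series K) (m : ℕ) (α β : K) : K :=
  ∑ i ∈ Finset.range (m + 1), cf f i (m - i) * (α ^ i * β ^ (m - i))

theorem form_of_tanY {f : Series K} {n : ℕ} (hn : f.order = n) (h : TanY f) (α β : K) :
    form f n α β = cf f 0 n * β ^ n := by
  rw [form, Finset.sum_eq_single 0]
  · simp
  · intro i hi hi0
    rw [((tanY_iff_cf hn).1 h).2 _ _ (by simp at hi; omega) (by omega), zero_mul]
  · simp

theorem form_zero_one (f : Series K) (n : ℕ) : form f n 0 1 = cf f 0 n := by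
  rw [form, Finset.sum_eq_single 0]
  · simp
  · intro i _ hi0
    simp [hi0]
  · simp

theorem form_one (f : Series K) (α β : K) : form f 1 α β = cf f 1 0 * α + cf f 0 1 * β := by
  simp [form, Finset.sum_range_succ, add_comm]

/-- The homogeneous part of degree `m`. -/
def homPart (f : Series K) (m : ℕ) : Series K :=
  ∑ i ∈ Finset.range (m + 1),
    MvPowerSeries.C (cf f i (m - i)) * (MvPowerSeries.X 0 ^ i * MvPowerSeries.X 1 ^ (m - i))

theorem cf_sum {ι : Type*} (s : Finset ι) (g : ι → Series K) (i j : ℕ) :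
    cf (∑ k ∈ s, g k) i j = ∑ k ∈ s, cf (g k) i j := by
  simp [cf]

theorem cf_homPart (f : Series K) (m i j : ℕ) :
    cf (homPart f m) i j = if i + j = m then cf f i j else 0 := by
  rw [homPart, cf_sum]
  simp only [cf_C_mul, cf_X_zero_pow_mul, cf_X_one_pow]
  split_ifs with h
  · rw [Finset.sum_eq_single i]
    · simp [← h]
    · intro k hk hki
      split_ifs <;> first | omega | simp
    · intro hi
      simp at hi
      omega
  · apply Finset.sum_eq_zero
    intro k hk
    simp at hk
    split_ifs <;> first | omega | simp

theorem le_order_sub_homPart {f : Series K} {m : ℕ} (hf : (m : ℕ∞) ≤ f.order) :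
    ((m + 1 : ℕ) : ℕ∞) ≤ (f - homPart f m).order := by
  rw [le_order_iff] at hf ⊢
  intro i j hij
  rw [cf_sub, cf_homPart]
  split_ifs with h
  · simp
  · rw [hf i j (by omega), sub_zero]

/-- Along an arc through the origin the lowest possible coefficient of f is its form of degree m at
the velocity vector, since the terms of higher degree contribute multiples of t^{m+1}. -/
theorem coeff_map_eq_form (θ : Series K →+* PowerSeries K)
    (hC : ∀ c, θ (MvPowerSeries.C c) = PowerSeries.C c)
    (h0 : PowerSeries.X ∣ θ (MvPowerSeries.X 0)) (h1 : PowerSeries.X ∣ θ (MvPowerSeries.X 1))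
    {f : Series K} {m : ℕ} (hf : (m : ℕ∞) ≤ f.order) :
    PowerSeries.coeff m (θ f) = form f m (PowerSeries.coeff 1 (θ (MvPowerSeries.X 0)))
      (PowerSeries.coeff 1 (θ (MvPowerSeries.X 1))) := by
  have hr := pow_dvd_map_of_le_order θ h0 h1 (le_order_sub_homPart hf)
  have h2 : PowerSeries.coeff m (θ f) = PowerSeries.coeff m (θ (homPart f m)) := by
    have := PowerSeries.X_pow_dvd_iff.1 hr m (by omega)
    rwa [map_sub, map_sub, sub_eq_zero] at this
  rw [h2]
  obtain ⟨a, ha⟩ := h0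
  obtain ⟨b, hb⟩ := h1
  rw [homPart, form, map_sum, map_sum]
  apply Finset.sum_congr rfl
  intro i hi
  have hi : i ≤ m := by simpa [Nat.lt_succ_iff] using hi
  have h3 : θ (MvPowerSeries.C (cf f i (m - i)) *
      (MvPowerSeries.X 0 ^ i * MvPowerSeries.X 1 ^ (m - i))) =
      PowerSeries.C (cf f i (m - i)) * (PowerSeries.X ^ m * (a ^ i * b ^ (m - i))) := by
    rw [map_mul, map_mul, map_pow, map_pow, hC, ha, hb]
    conv_rhs => rw [← Nat.add_sub_cancel' hi, pow_add]
    rw [Nat.add_sub_cancel' hi]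
    ring
  have hc : ∀ a : PowerSeries K, PowerSeries.coeff 1 (PowerSeries.X * a) =
      PowerSeries.constantCoeff a := by
    intro a
    simp
  rw [h3, PowerSeries.coeff_C_mul, PowerSeries.coeff_X_pow_mul', if_pos le_rfl, Nat.sub_self,
    ha, hb, hc, hc]
  simp

/-- Exchange of the variables. -/
def swap : Series K ≃ₐ[K] Series K := MvPowerSeries.renameEquiv K (Equiv.swap 0 1)

theorem swap_X_zero : swap (MvPowerSeries.X 0 : Series K) = MvPowerSeries.X 1 :=
  MvPowerSeries.rename_X _ _

theorem swap_X_one : swap (MvPowerSeries.X 1 : Series K) = MvPowerSeries.X 0 :=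
  MvPowerSeries.rename_X _ _

theorem map_C (σ : Series K ≃ₐ[K] Series K) (c : K) :
    σ (MvPowerSeries.C c) = MvPowerSeries.C c := σ.commutes c

theorem hasSubst_shear (a : K) : MvPowerSeries.HasSubst ![(MvPowerSeries.X 0 : Series K),
    MvPowerSeries.X 1 + MvPowerSeries.C a * MvPowerSeries.X 0] :=
  hasSubst_of_fin_two (by simp) (by simp)

/-- The substitution `f(x, y) ↦ f(x, y + a x)`. -/
def shearHom (a : K) : Series K →ₐ[K] Series K := MvPowerSeries.substAlgHom (hasSubst_shear a)

theorem shearHom_apply (a : K) (f : Series K) : shearHom a f =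
    MvPowerSeries.subst ![(MvPowerSeries.X 0 : Series K),
      MvPowerSeries.X 1 + MvPowerSeries.C a * MvPowerSeries.X 0] f :=
  MvPowerSeries.substAlgHom_apply _ _

theorem shearHom_X_zero (a : K) : shearHom a (MvPowerSeries.X 0) = MvPowerSeries.X 0 :=
  MvPowerSeries.substAlgHom_X (hasSubst_shear a) 0

theorem shearHom_X_one (a : K) : shearHom a (MvPowerSeries.X 1) =
    MvPowerSeries.X 1 + MvPowerSeries.C a * MvPowerSeries.X 0 :=
  MvPowerSeries.substAlgHom_X (hasSubst_shear a) 1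

theorem shearHom_C (a c : K) : shearHom a (MvPowerSeries.C c) = MvPowerSeries.C c :=
  (shearHom a).commutes c

theorem shearHom_neg_shearHom (a : K) (f : Series K) : shearHom (-a) (shearHom a f) = f := by
  rw [shearHom_apply (-a), shearHom_apply a,
    MvPowerSeries.subst_comp_subst_apply (hasSubst_shear a) (hasSubst_shear (-a))]
  have : (fun s => MvPowerSeries.subst ![(MvPowerSeries.X 0 : Series K),
      MvPowerSeries.X 1 + MvPowerSeries.C (-a) * MvPowerSeries.X 0]
      (![(MvPowerSeries.X 0 : Series K),
        MvPowerSeries.X 1 + MvPowerSeries.C a * MvPowerSeries.X 0] s)) = MvPowerSeries.X := by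
    funext s
    rw [← shearHom_apply]
    fin_cases s
    · exact shearHom_X_zero _
    · change shearHom (-a) (MvPowerSeries.X 1 + MvPowerSeries.C a * MvPowerSeries.X 0) = _
      rw [map_add, map_mul, shearHom_X_zero, shearHom_X_one, shearHom_C, map_neg]
      simp
  rw [this, MvPowerSeries.subst_self, id]

/-- The automorphism `f(x, y) ↦ f(x, y + a x)`. -/
def shear (a : K) : Series K ≃ₐ[K] Series K :=
  AlgEquiv.ofAlgHom (shearHom a) (shearHom (-a))
    (AlgHom.ext fun f => by simpa using shearHom_neg_shearHom (-a) f)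
    (AlgHom.ext fun f => shearHom_neg_shearHom a f)

theorem shear_apply (a : K) (f : Series K) : shear a f = shearHom a f := rfl

theorem shear_symm_apply (a : K) (f : Series K) : (shear a).symm f = shearHom (-a) f := rfl

theorem restr_C (c : K) : restr (MvPowerSeries.C c) = PowerSeries.C c := by
  simp [restr, iter_C]

theorem restr_X_zero : restr (MvPowerSeries.X 0 : Series K) = 0 := by
  simp [restr, iter_X_zero]

theorem restr_X_one : restr (MvPowerSeries.X 1 : Series K) = PowerSeries.X := by
  simp [restr, iter_X_one]

/-- The restriction `f(x, 0)`. -/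
def restrX : Series K →+* PowerSeries K :=
  PowerSeries.constantCoeff.comp ((iter (K := K)) : Series K →+* PowerSeries (PowerSeries K))

theorem coeff_restrX (f : Series K) (i : ℕ) : PowerSeries.coeff i (restrX f) = cf f i 0 := by
  simp [restrX, cf]

theorem restrX_C (c : K) : restrX (MvPowerSeries.C c) = PowerSeries.C c := by
  simp [restrX, iter_C]

theorem restrX_X_zero : restrX (MvPowerSeries.X 0 : Series K) = PowerSeries.X := by
  simp [restrX, iter_X_zero]

theorem restrX_X_one : restrX (MvPowerSeries.X 1 : Series K) = 0 := by
  simp [restrX, iter_X_one]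

theorem cf_shear_zero {f : Series K} {m : ℕ} (hf : (m : ℕ∞) ≤ f.order) (a : K) :
    cf (shear a f) m 0 = form f m 1 a := by
  have h := coeff_map_eq_form (restrX.comp (shear a : Series K →+* Series K))
    (fun c => by simp [map_C, restrX_C]) (by simp [shear_apply, shearHom_X_zero, restrX_X_zero])
    (by simp [shear_apply, shearHom_X_one, restrX_X_zero, restrX_X_one]) hf
  simpa [shear_apply, shearHom_X_one, shearHom_X_zero, restrX_X_zero, restrX_X_one, restrX_C,
    coeff_restrX] using h

theorem cf_zero_shear {f : Series K} {m : ℕ} (hf : (m : ℕ∞) ≤ f.order) (a : K) :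
    cf (shear a f) 0 m = cf f 0 m := by
  have h := coeff_map_eq_form (restr.comp (shear a : Series K →+* Series K))
    (fun c => by simp [map_C, restr_C]) (by simp [shear_apply, shearHom_X_zero, restr_X_zero])
    (by simp [shear_apply, shearHom_X_one, restr_X_zero, restr_X_one]) hf
  simpa [shear_apply, shearHom_X_one, shearHom_X_zero, restr_X_zero, restr_X_one, restr_C,
    coeff_restr, form_zero_one] using h

/-- The automorphism `f(x, y) ↦ f(x + b y, y)`. -/
def shearX (b : K) : Series K ≃ₐ[K] Series K := (swap.trans (shear b)).trans swap

theorem shearX_apply (b : K) (f : Series K) : shearX b f = swap (shearHom b (swap f)) := rfl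

theorem shearX_symm_apply (b : K) (f : Series K) :
    (shearX b).symm f = swap (shearHom (-b) (swap f)) := rfl

theorem cf_zero_shearX {f : Series K} {m : ℕ} (hf : (m : ℕ∞) ≤ f.order) (b : K) :
    cf (shearX b f) 0 m = form f m b 1 := by
  have h := coeff_map_eq_form (restr.comp (shearX b : Series K →+* Series K))
    (fun c => by simp [map_C, restr_C])
    (by simp [shearX_apply, shearHom_X_one, swap_X_zero, swap_X_one, restr_X_zero, restr_X_one])
    (by simp [shearX_apply, shearHom_X_zero, swap_X_zero, swap_X_one, restr_X_one]) hf
  simpa [shearX_apply, shearHom_X_zero, shearHom_X_one, swap_X_zero, swap_X_one, restr_X_zero,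
    restr_X_one, restr_C, coeff_restr, map_C] using h

theorem exists_cf_ne_zero {f : Series K} {m : ℕ} (hf : f.order = m) :
    ∃ i, i ≤ m ∧ cf f i (m - i) ≠ 0 := by
  by_contra! hc
  have : ((m + 1 : ℕ) : ℕ∞) ≤ f.order := by
    rw [le_order_iff]
    intro i j hij
    rcases Nat.lt_succ_iff_lt_or_eq.1 hij with h | h
    · exact le_order_iff.1 hf.ge _ _ h
    · rw [← hc i (by omega)]
      congr 1; omega
  rw [hf] at this
  exact absurd (Nat.cast_le.1 this) (by omega)

theorem exists_form_ne_zero [Infinite K] {f : Series K} {m : ℕ} (hf : f.order = m) :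
    ∃ b, form f m b 1 ≠ 0 := by
  by_contra! hc
  let P : Polynomial K := ∑ i ∈ Finset.range (m + 1), Polynomial.monomial i (cf f i (m - i))
  have hP : P = 0 := by
    apply Polynomial.funext
    intro b
    rw [Polynomial.eval_zero, ← hc b, form, Polynomial.eval_finsetSum]
    simp [Polynomial.eval_monomial]
  obtain ⟨i, hi, h⟩ := exists_cf_ne_zero hf
  apply h
  have := congrArg (fun Q => Polynomial.coeff Q i) hP
  simpa [P, Polynomial.finsetSum_coeff, Polynomial.coeff_monomial, Nat.lt_succ_iff, hi] using this

theorem exists_form_eq_zero [IsAlgClosed K] {f : Series K} {m : ℕ} (hm : 0 < m)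
    (hf : cf f 0 m ≠ 0) : ∃ a, form f m 1 a = 0 := by
  let P : Polynomial K := ∑ i ∈ Finset.range (m + 1), Polynomial.monomial (m - i) (cf f i (m - i))
  have hc : P.coeff m = cf f 0 m := by
    simp only [P, Polynomial.finsetSum_coeff, Polynomial.coeff_monomial]
    rw [Finset.sum_eq_single 0]
    · simp
    · intro i hi hi0
      rw [if_neg (by omega)]
    · simp
  have hd : P.degree ≠ 0 := by
    intro h
    have := Polynomial.le_degree_of_ne_zero (p := P) (n := m) (by rwa [hc])
    rw [h] at this
    have : m ≤ 0 := by exact_mod_cast this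
    omega
  obtain ⟨a, ha⟩ := IsAlgClosed.exists_root P hd
  refine ⟨a, ?_⟩
  rw [Polynomial.IsRoot.def, Polynomial.eval_finsetSum] at ha
  simpa [form, Polynomial.eval_monomial] using ha

/-! ### A branch has a single tangent. -/

theorem order_pos_of_irreducible {q : Series K} (hq : Irreducible q) : q.order ≠ 0 :=
  fun h => hq.not_isUnit (order_eq_zero_iff_isUnit.1 h)

/-- An irreducible power series containing `y^m`, where `m` is its order, is unitangent. -/
theorem exists_tanY_shear [IsAlgClosed K] {q : Series K} (hq : Irreducible q) {m : ℕ}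
    (hm : q.order = m) (hY : cf q 0 m ≠ 0) : ∃ a, TanY (shear a q) := by
  have hm0 : 0 < m := by
    have := order_pos_of_irreducible hq
    rw [hm] at this
    exact Nat.pos_of_ne_zero (by exact_mod_cast this)
  obtain ⟨a, ha⟩ := exists_form_eq_zero hm0 hY
  refine ⟨a, ?_⟩
  set r := shear a q with hr
  have hirr : Irreducible r := (MulEquiv.irreducible_iff (shear a)).2 hq
  have hrm : r.order = m := by rw [hr, order_map_equiv, hm]
  have hrY : cf r 0 m ≠ 0 := by rwa [hr, cf_zero_shear hm.ge]
  have hr0 : cf r m 0 = 0 := by rw [hr, cf_shear_zero hm.ge, ha]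
  have hordY : ordY r = m := le_antisymm (ordY_le_of_cf hrY) (hrm ▸ order_le_ordY r)
  obtain ⟨P, hP, hPm, hass⟩ := exists_contract hordY hrm
  have hr' : r ≠ 0 := hirr.ne_zero
  have hT := associated_transform hr' hass
  rw [transform_contract hP] at hT
  have hle := ordY_transform_le hr'
  rw [hrm] at hle
  obtain ⟨k, hk⟩ : ∃ k : ℕ, ordY (transform r) = k :=
    ⟨_, (ENat.natCast_toNat (ne_top_of_le_ne_top (ENat.natCast_ne_top _) hle)).symm⟩
  -- The slope a is a zero of the initial form, so x^m does not occur in r and the transform passes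
  -- through the origin.
  have hk0 : 0 < k := by
    rcases Nat.eq_zero_or_pos k with rfl | h
    · have := (ordY_eq_iff.1 hk).1
      rw [cf_transform hrm] at this
      simp [hr0] at this
    · exact h
  -- G is the part of the transform at the origin and H its cofactor. Contracting splits r as a
  -- product in which G gives order k > 0; irreducibility leaves degree 0 for H, so k = m.
  obtain ⟨G, hG, hGk, hGa⟩ := exists_distinguished hk
  obtain ⟨H, rfl⟩ := hG.dvd_of_ofPoly_dvd (hGa.symm.dvd.trans hT.dvd)
  have hH : H.Monic := hG.monic.of_mul_monic_left hP
  have hdeg := hG.monic.natDegree_mul hH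
  rw [contract_mul] at hass
  have hu : IsUnit (contract H) := by
    rcases (hass.irreducible hirr).isUnit_or_isUnit rfl with h | h
    · rw [← order_eq_zero_iff_isUnit, order_contract hG.monic] at h
      have : G.natDegree = 0 := by exact_mod_cast h
      omega
    · exact h
  rw [← order_eq_zero_iff_isUnit, order_contract hH] at hu
  have : H.natDegree = 0 := by exact_mod_cast hu
  refine ⟨hr', ?_⟩
  rw [hk, hrm]
  congr 1
  omega

/-- Irreducible power series are unitangent. -/
theorem exists_hasTangent [IsAlgClosed K] {q : Series K} (hq : Irreducible q) :
    ∃ α β : K, HasTangent q (MvPowerSeries.C α * MvPowerSeries.X 0 +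
      MvPowerSeries.C β * MvPowerSeries.X 1) := by
  have : Infinite K := IsAlgClosed.instInfinite
  obtain ⟨m, hm⟩ := exists_order_eq hq.ne_zero
  obtain ⟨b, hb⟩ := exists_form_ne_zero hm
  have hirr : Irreducible (shearX b q) := (MulEquiv.irreducible_iff (shearX b)).2 hq
  have hm' : (shearX b q).order = m := by rw [order_map_equiv, hm]
  obtain ⟨a, ha⟩ := exists_tanY_shear hirr hm' (by rwa [cf_zero_shearX hm.ge])
  have h := ((hasTangent_iff_tanY.2 ha).map (shear a).symm).map (shearX b).symm
  rw [AlgEquiv.symm_apply_apply, AlgEquiv.symm_apply_apply] at h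
  -- The image of y under the two inverse shears: y ↦ y - a x ↦ y - a (x - b y).
  refine ⟨-a, 1 + a * b, ?_⟩
  convert h using 1
  rw [shear_symm_apply, shearX_symm_apply, shearHom_X_one]
  simp only [map_add, map_mul, map_C, swap_X_one, swap_X_zero, shearHom_X_one, shearHom_X_zero,
    shearHom_C, map_neg, map_one]
  ring

theorem coeff_algHom_eq_form (θ : Series K →ₐ[K] PowerSeries K)
    (h0 : PowerSeries.X ∣ θ (MvPowerSeries.X 0)) (h1 : PowerSeries.X ∣ θ (MvPowerSeries.X 1))
    {f : Series K} {m : ℕ} (hf : (m : ℕ∞) ≤ f.order) :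
    PowerSeries.coeff m (θ f) = form f m (PowerSeries.coeff 1 (θ (MvPowerSeries.X 0)))
      (PowerSeries.coeff 1 (θ (MvPowerSeries.X 1))) :=
  coeff_map_eq_form (θ : Series K →+* PowerSeries K) (fun c => θ.commutes c) h0 h1 hf

theorem cf_swap (f : Series K) (i j : ℕ) : cf (swap f) i j = cf f j i := by
  have h := MvPowerSeries.coeff_embDomain_rename (Equiv.swap (0 : Fin 2) 1).toEmbedding f
    (Finsupp.single 0 j + Finsupp.single 1 i)
  rw [Finsupp.embDomain_add, Finsupp.embDomain_single, Finsupp.embDomain_single] at h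
  rw [cf_eq_coeff, cf_eq_coeff, ← h, add_comm]
  rfl

/-! ### Intersection with smooth curves through parametrizations. -/

theorem coeffs_surjective (k : ℕ) : Function.Surjective
    (LinearMap.pi fun i : Fin k => (PowerSeries.coeff (R := K) (i : ℕ))) := by
  intro v
  refine ⟨PowerSeries.mk fun n => if h : n < k then v ⟨n, h⟩ else 0, ?_⟩
  funext i
  simp

/-- A nonzero h is a unit times t^k, so the first k coefficients identify the quotient with K^k. For
h = 0 the quotient maps onto K^k for every k. -/
theorem toENat_rank_quotient_span (h : PowerSeries K) :
    Cardinal.toENat (Module.rank K (PowerSeries K ⧸ Ideal.span {h})) = h.order := by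
  by_cases h0 : h = 0
  · subst h0
    rw [PowerSeries.order_zero]
    refine ENat.eq_top_iff_forall_ge.2 fun k => ?_
    have h1 : Function.Surjective ((LinearMap.pi fun i : Fin k =>
        (PowerSeries.coeff (R := K) (i : ℕ))) ∘ₗ
        ((AlgEquiv.quotientBot K (PowerSeries K)).toLinearMap ∘ₗ
        (Ideal.quotientEquivAlgOfEq K
          (show Ideal.span {(0 : PowerSeries K)} = ⊥ by simp)).toLinearMap)) := by
      refine (coeffs_surjective k).comp ?_
      exact (AlgEquiv.quotientBot K (PowerSeries K)).surjective.comp (AlgEquiv.surjective _)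
    have h2 := LinearMap.rank_le_of_surjective _ h1
    rw [rank_fin_fun] at h2
    simpa using Cardinal.toENat.monotone' h2
  · obtain ⟨k, hk⟩ : ∃ k : ℕ, h.order = k :=
      ⟨_, (ENat.natCast_toNat (PowerSeries.order_eq_top.not.2 h0)).symm⟩
    have hker : (Ideal.span {h}).restrictScalars K = LinearMap.ker
        (LinearMap.pi fun i : Fin k => (PowerSeries.coeff (R := K) (i : ℕ))) := by
      ext a
      rw [Submodule.restrictScalars_mem, Ideal.mem_span_singleton, LinearMap.mem_ker]
      have h1 : h ∣ a ↔ PowerSeries.X ^ k ∣ a := by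
        have h2 := PowerSeries.X_pow_order_dvd (φ := h)
        obtain ⟨v, hv⟩ := h2
        rw [hk, ENat.toNat_natCast] at hv
        have hvu : IsUnit v := by
          rw [PowerSeries.isUnit_iff_constantCoeff, isUnit_iff_ne_zero]
          intro hv0
          have h3 := PowerSeries.coeff_order (φ := h) h0
          rw [hk, ENat.toNat_natCast, hv, PowerSeries.coeff_X_pow_mul', if_pos le_rfl,
            Nat.sub_self, PowerSeries.coeff_zero_eq_constantCoeff_apply] at h3
          exact h3 hv0
        rw [hv]
        exact hvu.mul_right_dvd
      rw [h1, PowerSeries.X_pow_dvd_iff]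
      constructor
      · intro ha
        funext i
        exact ha i i.2
      · intro ha i hi
        exact congrFun ha ⟨i, hi⟩
    have e : (PowerSeries K ⧸ Ideal.span {h}) ≃ₗ[K] (Fin k → K) :=
      (Submodule.Quotient.restrictScalarsEquiv K (Ideal.span {h})).symm ≪≫ₗ
        (Submodule.quotEquivOfEq _ _ hker) ≪≫ₗ
        (LinearMap.quotKerEquivOfSurjective _ (coeffs_surjective k))
    rw [e.rank_eq, rank_fin_fun, hk]
    simp

/-- `θ` is a parametrization of the curve `{w = 0}`. -/
structure IsParam (θ : Series K →ₐ[K] PowerSeries K) (w : Series K) : Prop where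
  surjective : Function.Surjective θ
  eq_zero_iff : ∀ b, θ b = 0 ↔ w ∣ b

/-- As θ is surjective with kernel (w), it induces K[[x,y]]/(p,w) ≅ K[[t]]/(θ p). -/
theorem IsParam.interNum_eq {θ : Series K →ₐ[K] PowerSeries K} {w : Series K} (h : IsParam θ w)
    (p : Series K) : interNum p w = (θ p).order := by
  have hs : Function.Surjective ((Ideal.Quotient.mkₐ K (Ideal.span {θ p})).comp θ) :=
    (Ideal.Quotient.mkₐ_surjective K _).comp h.surjective
  have hker : Ideal.span {p, w} =
      RingHom.ker ((Ideal.Quotient.mkₐ K (Ideal.span {θ p})).comp θ) := by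
    ext b
    rw [RingHom.mem_ker, AlgHom.comp_apply, Ideal.Quotient.mkₐ_eq_mk,
      Ideal.Quotient.eq_zero_iff_mem, Ideal.mem_span_singleton, Ideal.mem_span_pair]
    constructor
    · rintro ⟨a, c, rfl⟩
      have hw : θ w = 0 := (h.eq_zero_iff w).2 dvd_rfl
      simp [hw]
    · rintro ⟨a, ha⟩
      obtain ⟨a, rfl⟩ := h.surjective a
      have : θ (b - p * a) = 0 := by rw [map_sub, map_mul, ha, sub_self]
      obtain ⟨c, hc⟩ := (h.eq_zero_iff _).1 this
      exact ⟨a, c, by linear_combination -hc⟩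
  rw [interNum, ← toENat_rank_quotient_span]
  congr 1
  exact ((Ideal.quotientEquivAlgOfEq K hker).trans
    (Ideal.quotientKerAlgEquivOfSurjective hs)).toLinearEquiv.rank_eq

theorem IsParam.congr {θ : Series K →ₐ[K] PowerSeries K} {w w' : Series K} (h : IsParam θ w)
    (ha : Associated w w') : IsParam θ w' :=
  ⟨h.surjective, fun b => (h.eq_zero_iff b).trans ha.dvd_iff_dvd_left⟩

/-- The evaluation y ↦ φ is the composite A[[y]] → A[[y]]/(y-φ) ≅ A[y]/(y-φ) ≅ A; Weierstrass
division replaces the summation of an infinite series. -/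
theorem exists_evaluation {A : Type*} [CommRing A] {I : Ideal A} [IsAdicComplete I A] {φ : A}
    (hφ : φ ∈ I) : ∃ θ : PowerSeries A →+* A, (∀ P : Polynomial A, θ P = P.eval φ) ∧
      ∀ b, θ b = 0 ↔ ((Polynomial.X - Polynomial.C φ : Polynomial A) : PowerSeries A) ∣ b := by
  have hG : (Polynomial.X - Polynomial.C φ).IsDistinguishedAt I := by
    rcases subsingleton_or_nontrivial A with hA | hA
    · exact ⟨⟨fun {n} hn => by rw [Subsingleton.elim (Polynomial.coeff _ n) 0]; exact I.zero_mem⟩,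
        Polynomial.monic_X_sub_C φ⟩
    refine ⟨⟨fun {n} hn => ?_⟩, Polynomial.monic_X_sub_C φ⟩
    rw [Polynomial.natDegree_X_sub_C] at hn
    obtain rfl : n = 0 := by omega
    simpa using hφ
  let E := (Polynomial.quotientSpanXSubCAlgEquiv φ)
  let F := hG.algEquivQuotient
  refine ⟨E.toRingEquiv.toRingHom.comp (F.symm.toRingEquiv.toRingHom.comp (Ideal.Quotient.mk _)),
    ?_, ?_⟩
  · intro P
    have : Ideal.Quotient.mk _ (P : PowerSeries A) = F (Ideal.Quotient.mk _ P) := by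
      change _ = Ideal.Quotient.mk _ (Polynomial.coeToPowerSeries.algHom _ P)
      simp
    simp [this, E]
  · intro b
    simp [Ideal.Quotient.eq_zero_iff_mem, Ideal.mem_span_singleton]

theorem exists_isParam_graph {φ : PowerSeries K} (hφ : PowerSeries.coeff 0 φ = 0) :
    ∃ θ : Series K →ₐ[K] PowerSeries K,
      IsParam θ (ofPoly (Polynomial.X - Polynomial.C φ)) ∧
      ∀ P : Polynomial (PowerSeries K), θ (ofPoly P) = P.eval φ := by
  obtain ⟨θ, h1, h2⟩ := exists_evaluation (mem_maximalIdeal_iff.2 hφ)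
  have h3 : ∀ P : Polynomial (PowerSeries K), θ (iter (ofPoly P)) = P.eval φ := by
    intro P
    rw [iter_ofPoly, h1]
  let ψ : Series K →ₐ[K] PowerSeries K :=
    { toRingHom := θ.comp (iter (K := K) : Series K →+* PowerSeries (PowerSeries K))
      commutes' := fun c => by
        change θ (iter (MvPowerSeries.C c)) = _
        have := h1 (Polynomial.C (PowerSeries.C c))
        rw [Polynomial.coe_C, Polynomial.eval_C] at this
        rw [iter_C, this]
        rfl }
  refine ⟨ψ, ⟨fun a => ⟨ofPoly (Polynomial.C a), ?_⟩, fun b => ?_⟩, h3⟩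
  · exact (h3 _).trans (by simp)
  · refine (h2 _).trans ?_
    rw [← iter_ofPoly]
    exact map_dvd_iff (iter (K := K))

/-- Implicit function theorem as Weierstrass preparation in degree one. -/
theorem exists_graph {w : Series K} (hw : ordY w = 1) :
    ∃ φ : PowerSeries K, PowerSeries.coeff 0 φ = 0 ∧
      Associated w (ofPoly (Polynomial.X - Polynomial.C φ)) := by
  obtain ⟨P, hP, hd, ha⟩ := exists_distinguished (n := 1) (by exact_mod_cast hw)
  have h1 := hP.monic.eq_X_add_C hd
  refine ⟨-P.coeff 0, ?_, ?_⟩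
  · rw [map_neg, neg_eq_zero, ← mem_maximalIdeal_iff]
    exact hP.mem (by omega)
  · rwa [map_neg, sub_neg_eq_add, ← h1]

/-- Every smooth curve has a parametrization by `t = x` or by `t = y`. -/
theorem exists_isParam {w : Series K} (hw : w.order = 1) :
    ∃ θ : Series K →ₐ[K] PowerSeries K, IsParam θ w ∧
      PowerSeries.X ∣ θ (MvPowerSeries.X 0) ∧ PowerSeries.X ∣ θ (MvPowerSeries.X 1) ∧
      (cf w 0 1 ≠ 0 → PowerSeries.coeff 1 (θ (MvPowerSeries.X 0)) = 1) ∧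
      (cf w 0 1 = 0 → PowerSeries.coeff 1 (θ (MvPowerSeries.X 0)) = 0 ∧
        PowerSeries.coeff 1 (θ (MvPowerSeries.X 1)) = 1) := by
  have main : ∀ w : Series K, w.order = 1 → cf w 0 1 ≠ 0 →
      ∃ θ : Series K →ₐ[K] PowerSeries K, IsParam θ w ∧
      θ (MvPowerSeries.X 0) = PowerSeries.X ∧ PowerSeries.X ∣ θ (MvPowerSeries.X 1) := by
    intro w hw h
    have h1 : ordY w = 1 :=
      le_antisymm (by exact_mod_cast ordY_le_of_cf h) (hw ▸ order_le_ordY w)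
    obtain ⟨φ, hφ, ha⟩ := exists_graph h1
    obtain ⟨θ, hθ, he⟩ := exists_isParam_graph hφ
    refine ⟨θ, hθ.congr ha.symm, ?_, ?_⟩
    · rw [← ofPoly_C_X, he, Polynomial.eval_C]
    · rw [← ofPoly_X, he, Polynomial.eval_X, PowerSeries.X_dvd_iff]
      simpa using hφ
  by_cases h : cf w 0 1 = 0
  · have hsw : (swap w).order = 1 := by rw [order_map_equiv, hw]
    have h1 : cf w 1 0 ≠ 0 := by
      obtain ⟨i, hi, hi'⟩ := exists_cf_ne_zero (m := 1) (by exact_mod_cast hw)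
      rcases Nat.le_one_iff_eq_zero_or_eq_one.1 hi with rfl | rfl
      · exact absurd h hi'
      · exact hi'
    obtain ⟨θ, hθ, h2, h3⟩ := main (swap w) hsw (by rwa [cf_swap])
    have hX0 : θ.comp (swap (K := K) : Series K →ₐ[K] Series K) (MvPowerSeries.X 0) =
      θ (MvPowerSeries.X 1) := by simp [swap_X_zero]
    have hX1 : θ.comp (swap (K := K) : Series K →ₐ[K] Series K) (MvPowerSeries.X 1) =
      PowerSeries.X := by simp [swap_X_one, h2]
    have hp : IsParam (θ.comp (swap (K := K) : Series K →ₐ[K] Series K)) w := by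
      refine ⟨hθ.surjective.comp swap.surjective, fun b => ?_⟩
      exact (hθ.eq_zero_iff (swap b)).trans (map_dvd_iff swap)
    refine ⟨_, hp, ?_, ?_, fun h' => absurd h h', fun _ => ⟨?_, ?_⟩⟩
    · rwa [hX0]
    · rw [hX1]
    -- w vanishes along its own parametrization, so its linear part kills the velocity vector; only
    -- the x-term of that linear part is present.
    · have h4 := coeff_algHom_eq_form (θ.comp (swap (K := K) : Series K →ₐ[K] Series K))
        (by rwa [hX0]) (by rw [hX1]) (f := w) (m := 1) (by exact_mod_cast hw.ge)
      rw [(hp.eq_zero_iff w).2 dvd_rfl, form_one, h] at h4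
      simpa [h1] using h4
    · rw [hX1, PowerSeries.coeff_one_X]
  · obtain ⟨θ, hθ, h2, h3⟩ := main w hw h
    exact ⟨θ, hθ, by rw [h2], h3, fun _ => by rw [h2, PowerSeries.coeff_one_X],
      fun h' => absurd h' h⟩

theorem IsParam.le_interNum {θ : Series K →ₐ[K] PowerSeries K} {w : Series K} (h : IsParam θ w)
    (h0 : PowerSeries.X ∣ θ (MvPowerSeries.X 0)) (h1 : PowerSeries.X ∣ θ (MvPowerSeries.X 1))
    (p : Series K) : p.order ≤ interNum p w := by
  rw [h.interNum_eq]
  refine ENat.forall_natCast_le_iff_le.1 fun n hn => ?_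
  have := pow_dvd_map_of_le_order (θ : Series K →+* PowerSeries K) h0 h1 hn
  exact PowerSeries.nat_le_order _ _ fun i hi => PowerSeries.X_pow_dvd_iff.1 this i hi

theorem order_le_interNum (p : Series K) {w : Series K} (hw : w.order = 1) :
    p.order ≤ interNum p w := by
  obtain ⟨θ, hθ, h0, h1, -, -⟩ := exists_isParam hw
  exact hθ.le_interNum h0 h1 p

/-- If the velocity vector is not a zero of the form of degree m, then the coefficient of t^m in θ p
is nonzero. -/
theorem IsParam.interNum_le {θ : Series K →ₐ[K] PowerSeries K} {w : Series K} (h : IsParam θ w)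
    (h0 : PowerSeries.X ∣ θ (MvPowerSeries.X 0)) (h1 : PowerSeries.X ∣ θ (MvPowerSeries.X 1))
    {p : Series K} {m : ℕ} (hp : (m : ℕ∞) ≤ p.order)
    (hform : form p m (PowerSeries.coeff 1 (θ (MvPowerSeries.X 0)))
      (PowerSeries.coeff 1 (θ (MvPowerSeries.X 1))) ≠ 0) : interNum p w ≤ m := by
  rw [h.interNum_eq]
  apply PowerSeries.order_le
  rwa [← coeff_algHom_eq_form θ h0 h1 hp] at hform

/-- A smooth curve that is not tangent to `p` meets it with multiplicity at most `ord p`. -/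
theorem interNum_le_of_not_tanY {p w : Series K} (hp : TanY p) (hw : w.order = 1)
    (hnt : ¬ TanY w) : interNum p w ≤ p.order := by
  obtain ⟨m, hm⟩ := exists_order_eq hp.1
  obtain ⟨θ, hθ, h0, h1, hY, hX⟩ := exists_isParam hw
  rw [hm]
  refine hθ.interNum_le h0 h1 hm.ge ?_
  rw [form_of_tanY hm hp]
  refine mul_ne_zero ((tanY_iff_cf hm).1 hp).1 (pow_ne_zero _ ?_)
  by_cases h : cf w 0 1 = 0
  · rw [(hX h).2]
    exact one_ne_zero
  · intro hβ
    -- A velocity vector (1,0) would make the x-coefficient of w vanish, and w would be tangent to y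
    -- = 0.
    have h4 := coeff_algHom_eq_form θ h0 h1 (f := w) (m := 1) (by exact_mod_cast hw.ge)
    rw [(hθ.eq_zero_iff w).2 dvd_rfl, form_one, hβ, hY h] at h4
    have h10 : cf w 1 0 = 0 := by simpa using h4.symm
    apply hnt
    rw [tanY_iff_cf (n := 1) (by exact_mod_cast hw)]
    refine ⟨h, fun i j hij hi => ?_⟩
    obtain ⟨rfl, rfl⟩ : i = 1 ∧ j = 0 := by omega
    exact h10

/-- The velocity vector of v is (0,1), where the initial form of p takes the coefficient of y^m as
its value. -/
theorem interNum_le_of_vertical {p v : Series K} {m : ℕ} (hm : p.order = m) (hp : cf p 0 m ≠ 0)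
    (hv : v.order = 1) (hnt : cf v 0 1 = 0) : interNum p v ≤ m := by
  obtain ⟨θ, hθ, h0, h1, -, hX⟩ := exists_isParam hv
  refine hθ.interNum_le h0 h1 hm.ge ?_
  rwa [(hX hnt).1, (hX hnt).2, form_zero_one]

theorem contract_X_sub_C {φ : PowerSeries K} :
    contract (Polynomial.X - Polynomial.C φ) =
      ofPoly (Polynomial.X - Polynomial.C (φ * PowerSeries.X)) := by
  rw [contract, sub_eq_add_neg, ← Polynomial.C_neg, Polynomial.X_add_C_scaleRoots]
  simp [sub_eq_add_neg]

/-- The intersection number of tangent curves drops by the multiplicity under the strict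
transform. -/
theorem interNum_eq_add {p w : Series K} (hp : TanY p) (hw : w.order = 1) (hwt : TanY w) :
    interNum p w = p.order + interNum (transform p) (transform w) := by
  obtain ⟨P, hP, hpa, hTa⟩ := hp.exists_contract
  obtain ⟨Q, hQ, hwa, hTw⟩ := hwt.exists_contract
  have hQ1 : Q.natDegree = 1 := by
    have := order_eq_of_associated hwa
    rw [hw, order_contract hQ.monic] at this
    exact_mod_cast this.symm
  have hQe : Q = Polynomial.X - Polynomial.C (-Q.coeff 0) := by
    rw [map_neg, sub_neg_eq_add]
    exact hQ.monic.eq_X_add_C hQ1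
  set φ := -Q.coeff 0
  have hφ : PowerSeries.coeff 0 φ = 0 := by
    rw [map_neg, neg_eq_zero, ← mem_maximalIdeal_iff]
    exact hQ.mem (by omega)
  rw [hQe] at hwa hTw
  rw [contract_X_sub_C] at hwa
  obtain ⟨θ, hθ, he⟩ := exists_isParam_graph hφ
  obtain ⟨η, hη, he'⟩ := exists_isParam_graph (φ := φ * PowerSeries.X) (by simp)
  rw [(hθ.congr hTw.symm).interNum_eq, (hη.congr hwa.symm).interNum_eq]
  have hassoc : ∀ {θ : Series K →ₐ[K] PowerSeries K} {a b : Series K}, Associated a b →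
      (θ a).order = (θ b).order := by
    rintro θ a b ⟨u, rfl⟩
    rw [map_mul, PowerSeries.order_mul,
      PowerSeries.order_zero_of_unit (u.isUnit.map θ), add_zero]
  -- The polynomial with scaled roots evaluated at xφ is x^n P(φ); the factor x^n accounts for the
  -- summand ord p.
  rw [hassoc hpa, hassoc hTa, he, order_eq_of_associated hpa, order_contract hP.monic, contract,
    he', mul_comm φ, Polynomial.scaleRoots_eval_mul, PowerSeries.order_mul, PowerSeries.order_X_pow]

/-- If the multiplicity of a branch drops under the strict transform, then the intersection
numbers with smooth tangent curves are small. -/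
theorem interNum_transform_le [IsAlgClosed K] {p w : Series K} (hp : TanY p) (hirr : Irreducible p)
    (hlt : (transform p).order < p.order) (hw : w.order = 1) (hwt : TanY w) :
    interNum (transform p) (transform w) ≤ (transform p).order := by
  have hq := hp.irreducible_transform hirr
  obtain ⟨m, hm⟩ := exists_order_eq hq.ne_zero
  have hm0 : m ≠ 0 := by
    have := order_pos_of_irreducible hq
    rw [hm] at this
    exact_mod_cast this
  have hYw : ordY (transform w) = 1 := by rw [hwt.2, hw]
  have hTw : (transform w).order = 1 := by
    refine le_antisymm (hYw ▸ order_le_ordY _) ?_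
    rw [Order.one_le_iff_ne_zero, ne_eq, order_eq_zero_iff_isUnit, ← ordY_eq_zero_iff_isUnit, hYw]
    exact one_ne_zero
  have hcw : cf (transform w) 0 1 ≠ 0 := ((ordY_eq_iff (n := 1)).1 (by exact_mod_cast hYw)).1
  obtain ⟨θ, hθ, h0, h1, hY, -⟩ := exists_isParam hTw
  obtain ⟨a, b, m', hm', c, hc, hr⟩ := exists_hasTangent hq
  obtain rfl : m = m' := by
    rw [hm] at hm'
    exact_mod_cast hm'
  -- The transform restricted to x = 0 has order ord p > m, so y^m is missing and the tangent a x +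
  -- b y = 0 of the transform must be x = 0.
  have hqY : cf (transform p) 0 m = 0 := by
    refine (le_ordY_iff (n := m + 1)).1 ?_ m m.lt_succ_self
    rw [hp.2]
    push_cast
    exact Order.add_one_le_of_lt (hm ▸ hlt)
  have hb : b = 0 := by
    have h2 := le_order_iff.1 hr 0 m (by omega)
    rw [cf_sub, hqY, zero_sub, neg_eq_zero, cf_C_mul, ← coeff_restr, map_pow] at h2
    simpa [restr_X_zero, restr_X_one, restr_C, mul_pow, ← map_pow, PowerSeries.coeff_C_mul,
      PowerSeries.coeff_X_pow, hc, hm0] using h2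
  subst hb
  rw [map_zero, zero_mul, add_zero, mul_pow, ← map_pow] at hr
  have hcf : ∀ i, i ≤ m → cf (transform p) i (m - i) = if i = m then c * a ^ m else 0 := by
    intro i hi
    have h2 := le_order_iff.1 hr i (m - i) (by omega)
    rw [cf_sub, cf_C_mul, cf_C_mul, cf_X_zero_pow, sub_eq_zero] at h2
    rw [h2]
    split_ifs <;> first | omega | simp
  rw [hm]
  refine hθ.interNum_le h0 h1 hm.ge ?_
  obtain ⟨i, hi, hi'⟩ := exists_cf_ne_zero hm
  rw [hcf i hi] at hi'
  -- The velocity vector of the transform of w has first coordinate 1, and the initial form c a^m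
  -- x^m does not vanish there.
  rw [hY hcw, form, Finset.sum_eq_single m]
  · rw [hcf m le_rfl]
    simp only [one_pow, Nat.sub_self, pow_zero, mul_one, if_true]
    intro h
    rw [h] at hi'
    simp at hi'
  · intro i hi him
    rw [hcf i (by simpa [Nat.lt_succ_iff] using hi), if_neg him, zero_mul]
  · simp

/-! ### Contact of branches, of reduced curves, and the contact exponent. -/

instance isDomain_series : IsDomain (Series K) := NoZeroDivisors.to_isDomain _

theorem wfDvdMonoid_series : WfDvdMonoid (Series K) := IsNoetherianRing.wfDvdMonoid

theorem interNum_congr {p p' w w' : Series K} (hp : Associated p p') (hw : Associated w w') :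
    interNum p w = interNum p' w' := by
  have : Ideal.span ({p, w} : Set (Series K)) = Ideal.span {p', w'} := by
    rw [Ideal.span_insert, Ideal.span_insert, Ideal.span_singleton_eq_span_singleton.2 hp,
      Ideal.span_singleton_eq_span_singleton.2 hw]
  rw [interNum, this]
  rfl

theorem branchContact_congr {p p' w w' : Series K} (hp : Associated p p')
    (hw : Associated w w') : branchContact p w = branchContact p' w' := by
  rw [branchContact, branchContact, interNum_congr hp hw, mult, mult, mult, mult,
    order_eq_of_associated hp, order_eq_of_associated hw]

/-- Up to a unit, w is its only irreducible divisor, so the inner infimum collapses. -/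
theorem contact_eq {f w : Series K} (hw : Irreducible w) :
    contact f w = ⨅ (p : Series K) (_ : Irreducible p ∧ p ∣ f), branchContact p w := by
  refine iInf_congr fun p => iInf_congr fun hp => le_antisymm (iInf₂_le w ⟨hw, dvd_rfl⟩) ?_
  refine le_iInf₂ fun q hq => ?_
  have ha := (hq.1.dvd_irreducible_iff_associated hw).1 hq.2
  rw [branchContact_congr (Associated.refl p) ha]

theorem irreducible_of_order_eq_one {w : Series K} (hw : w.order = 1) : Irreducible w := by
  refine ⟨fun h => ?_, fun a b hab => ?_⟩
  · rw [order_eq_zero_iff_isUnit.2 h] at hw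
    exact zero_ne_one hw
  · rw [hab, MvPowerSeries.order_mul] at hw
    rw [← order_eq_zero_iff_isUnit, ← order_eq_zero_iff_isUnit]
    by_contra! hc
    have := add_le_add (Order.one_le_iff_ne_zero.2 hc.1) (Order.one_le_iff_ne_zero.2 hc.2)
    rw [hw] at this
    exact absurd this (by decide)

theorem isSmoothBranch_iff {w : Series K} : IsSmoothBranch w ↔ w.order = 1 :=
  ⟨fun h => h.2, fun h => ⟨irreducible_of_order_eq_one h, h⟩⟩

theorem TanY.order_transform_le {f : Series K} (h : TanY f) : (transform f).order ≤ f.order :=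
  h.2 ▸ order_le_ordY _

theorem TanY.order_transform_eq_one {w : Series K} (h : TanY w) (hw : w.order = 1) :
    (transform w).order = 1 := by
  refine le_antisymm (hw ▸ h.order_transform_le) ?_
  rw [Order.one_le_iff_ne_zero, ne_eq, order_eq_zero_iff_isUnit]
  intro hu
  rw [order_eq_zero_iff_isUnit.2 (h.isUnit_of_transform hu)] at hw
  exact zero_ne_one hw

theorem branchContact_eq_div {p w : Series K} {n : ℕ} (hn : p.order = n) (hw : w.order = 1) :
    branchContact p w = (interNum p w : ℝ≥0∞) / n := by
  rw [branchContact, mult, mult, hn, hw]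
  simp

theorem natCast_ne_zero_of_irreducible {p : Series K} (hp : Irreducible p) {n : ℕ}
    (hn : p.order = n) : (n : ℝ≥0∞) ≠ 0 := by
  have := order_pos_of_irreducible hp
  rw [hn] at this
  exact_mod_cast this

theorem branchContact_le_one {p w : Series K} (hp : Irreducible p) (hw : w.order = 1)
    (h : interNum p w ≤ p.order) : branchContact p w ≤ 1 := by
  obtain ⟨n, hn⟩ := exists_order_eq hp.ne_zero
  rw [branchContact_eq_div hn hw, ENNReal.div_le_iff (natCast_ne_zero_of_irreducible hp hn)
    (ENNReal.natCast_ne_top n), one_mul, ← ENat.toENNReal_coe, ENat.toENNReal_le]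
  exact hn ▸ h

theorem one_le_branchContact {p w : Series K} (hp : Irreducible p) (hw : w.order = 1) :
    1 ≤ branchContact p w := by
  obtain ⟨n, hn⟩ := exists_order_eq hp.ne_zero
  rw [branchContact_eq_div hn hw, ENNReal.le_div_iff_mul_le
    (Or.inl (natCast_ne_zero_of_irreducible hp hn))
    (Or.inl (ENNReal.natCast_ne_top n)), one_mul, ← ENat.toENNReal_coe, ENat.toENNReal_le]
  exact hn ▸ order_le_interNum p hw

theorem branchContact_eq_add_one {p w : Series K} (hp : Irreducible p) (hpt : TanY p)
    (hT : (transform p).order = p.order) (hw : w.order = 1) (hwt : TanY w) :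
    branchContact p w = branchContact (transform p) (transform w) + 1 := by
  obtain ⟨n, hn⟩ := exists_order_eq hp.ne_zero
  rw [branchContact_eq_div hn hw, branchContact_eq_div (hT.trans hn)
    (hwt.order_transform_eq_one hw), interNum_eq_add hpt hw hwt, ENat.toENNReal_add, hn,
    ENNReal.add_div, ENat.toENNReal_coe, ENNReal.div_self (natCast_ne_zero_of_irreducible hp hn)
    (ENNReal.natCast_ne_top n), add_comm]

/-- If the multiplicity of a branch drops under the strict transform, then its contact with
smooth curves is bounded away from two. -/
theorem exists_branchContact_le [IsAlgClosed K] {p : Series K} (hp : Irreducible p) (hpt : TanY p)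
    (hT : (transform p).order < p.order) :
    ∃ b : ℝ≥0∞, b < 2 ∧ ∀ w : Series K, w.order = 1 → branchContact p w ≤ b := by
  obtain ⟨n, hn⟩ := exists_order_eq hp.ne_zero
  obtain ⟨m, hm⟩ := exists_order_eq (transform_ne_zero hp.ne_zero)
  have hn0 := natCast_ne_zero_of_irreducible hp hn
  have hmn : m < n := by
    rw [hn, hm] at hT
    exact_mod_cast hT
  -- For tangent w, n comes from `interNum_eq_add` and at most m from `interNum_transform_le`;
  -- nontangent w give at most n.
  refine ⟨((n + m : ℕ) : ℝ≥0∞) / n, ?_, fun w hw => ?_⟩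
  · rw [ENNReal.div_lt_iff (Or.inl hn0) (Or.inl (ENNReal.natCast_ne_top n))]
    have : n + m < 2 * n := by omega
    exact_mod_cast this
  · rw [branchContact_eq_div hn hw]
    refine ENNReal.div_le_div_right ?_ _
    rw [← ENat.toENNReal_coe, ENat.toENNReal_le]
    push_cast
    by_cases hwt : TanY w
    · rw [interNum_eq_add hpt hw hwt, hn, ← hm]
      exact add_le_add le_rfl (interNum_transform_le hpt hp hT hw hwt)
    · exact (interNum_le_of_not_tanY hpt hw hwt).trans (hn ▸ le_self_add)

theorem order_transform_eq_of_dvd {f p : Series K} (hf : TanY f)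
    (h : (transform f).order = f.order) (hd : p ∣ f) : (transform p).order = p.order := by
  obtain ⟨k, rfl⟩ := hd
  obtain ⟨hp, hk⟩ := hf.of_mul
  rw [transform_mul hp.1 hk.1, MvPowerSeries.order_mul, MvPowerSeries.order_mul] at h
  have h1 := hp.order_transform_le
  have h2 := hk.order_transform_le
  obtain ⟨a, ha⟩ := exists_order_eq hp.1
  obtain ⟨b, hb⟩ := exists_order_eq hk.1
  obtain ⟨c, hc⟩ := exists_order_eq (transform_ne_zero hp.1)
  obtain ⟨d, hd⟩ := exists_order_eq (transform_ne_zero hk.1)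
  rw [ha, hb, hc, hd] at h
  rw [ha, hc] at h1 ⊢
  rw [hb, hd] at h2
  norm_cast at h h1 h2 ⊢
  omega

theorem order_transform_eq {f : Series K} (hf : TanY f)
    (h : ∀ p, Irreducible p → p ∣ f → (transform p).order = p.order) :
    (transform f).order = f.order := by
  have := wfDvdMonoid_series (K := K)
  revert hf h
  refine WfDvdMonoid.induction_on_irreducible f (fun h => absurd rfl h.1) ?_ ?_
  · intro u hu _ _
    rw [order_eq_zero_iff_isUnit.2 hu, order_eq_zero_iff_isUnit.2 (isUnit_transform hu)]
  · intro a i ha hi ih hf h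
    rw [transform_mul hi.ne_zero ha, MvPowerSeries.order_mul, MvPowerSeries.order_mul,
      h i hi (Dvd.intro _ rfl),
      ih hf.of_mul.2 fun p hp hd => h p hp (hd.trans (Dvd.intro_left _ rfl))]

/-- Up to units the branches of the transform are exactly the transforms of the branches of f, so
both infima run over the same values. -/
theorem contact_transform {f w : Series K} (hf : TanY f) (hw : w.order = 1) (hwt : TanY w) :
    contact (transform f) (transform w) =
      ⨅ (p : Series K) (_ : Irreducible p ∧ p ∣ f), branchContact (transform p) (transform w) := by
  rw [contact_eq (irreducible_of_order_eq_one (hwt.order_transform_eq_one hw))]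
  apply le_antisymm
  · refine le_iInf₂ fun p hp => ?_
    exact iInf₂_le (transform p)
      ⟨(hf.of_dvd hp.2).irreducible_transform hp.1, hf.transform_dvd hp.2⟩
  · refine le_iInf₂ fun q hq => ?_
    obtain ⟨p, hp, hpf, ha⟩ := hf.exists_irreducible_of_dvd_transform hq.1 hq.2
    rw [← branchContact_congr ha (Associated.refl _)]
    exact iInf₂_le p ⟨hp, hpf⟩

/-- Every branch keeps its multiplicity, so every term of the infimum drops by exactly one. -/
theorem contact_eq_add_one {f w : Series K} (hf : TanY f)
    (hT : (transform f).order = f.order) (hw : w.order = 1) (hwt : TanY w) :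
    contact f w = contact (transform f) (transform w) + 1 := by
  rw [contact_transform hf hw hwt, contact_eq (irreducible_of_order_eq_one hw)]
  simp only [ENNReal.iInf_add]
  refine iInf_congr fun p => iInf_congr fun hp => ?_
  exact branchContact_eq_add_one hp.1 (hf.of_dvd hp.2) (order_transform_eq_of_dvd hf hT hp.2)
    hw hwt

theorem exists_irreducible_dvd {f : Series K} (h0 : f ≠ 0) (hf : ¬ IsUnit f) :
    ∃ p, Irreducible p ∧ p ∣ f := by
  have := wfDvdMonoid_series (K := K)
  exact WfDvdMonoid.exists_irreducible_factor hf h0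

theorem contact_le {f w p : Series K} (hw : w.order = 1) (hp : Irreducible p) (hd : p ∣ f) :
    contact f w ≤ branchContact p w := by
  rw [contact_eq (irreducible_of_order_eq_one hw)]
  exact iInf₂_le p ⟨hp, hd⟩

theorem contact_le_contactExponent (f : Series K) {w : Series K} (hw : w.order = 1) :
    contact f w ≤ contactExponent f :=
  le_iSup₂_of_le w (isSmoothBranch_iff.2 hw) le_rfl

theorem contact_le_one {f w : Series K} (hf : TanY f) (hu : ¬ IsUnit f) (hw : w.order = 1)
    (hwt : ¬ TanY w) : contact f w ≤ 1 := by
  obtain ⟨p, hp, hpf⟩ := exists_irreducible_dvd hf.1 hu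
  exact (contact_le hw hp hpf).trans
    (branchContact_le_one hp hw (interNum_le_of_not_tanY (hf.of_dvd hpf) hw hwt))

/-- One branch losing multiplicity would bound the contact of f with all smooth curves by a single b
< 2. The uniformity matters, because the exponent is a supremum. -/
theorem order_transform_eq_of_two_le [IsAlgClosed K] {f : Series K} (hf : TanY f)
    (h : 2 ≤ contactExponent f) : (transform f).order = f.order := by
  apply order_transform_eq hf
  intro p hp hd
  refine le_antisymm (hf.of_dvd hd).order_transform_le ?_
  by_contra! hlt
  obtain ⟨b, hb, hle⟩ := exists_branchContact_le hp (hf.of_dvd hd) hlt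
  refine absurd (h.trans ?_) (not_le.2 hb)
  refine iSup₂_le fun w hw => ?_
  exact (contact_le hw.2 hp hd).trans (hle w hw.2)

theorem tanY_X_one : TanY (MvPowerSeries.X 1 : Series K) := by
  rw [← hasTangent_iff_tanY]
  refine ⟨1, ?_, 1, one_ne_zero, by simp⟩
  rw [← swap_X_zero, order_map_equiv, ← pow_one (MvPowerSeries.X 0), order_X_zero_pow]

theorem order_X_one : (MvPowerSeries.X 1 : Series K).order = 1 := by
  rw [← swap_X_zero, order_map_equiv, ← pow_one (MvPowerSeries.X 0), order_X_zero_pow]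
  rfl

/-- The line y = 0 is a witness: its contact with a branch is one more than that of the transforms,
which is at least one. -/
theorem two_le_contactExponent {f : Series K} (hf : TanY f)
    (hT : (transform f).order = f.order) : 2 ≤ contactExponent f := by
  refine le_trans ?_ (contact_le_contactExponent f order_X_one)
  rw [contact_eq (irreducible_of_order_eq_one order_X_one)]
  refine le_iInf₂ fun p hp => ?_
  have hpt := hf.of_dvd hp.2
  rw [branchContact_eq_add_one hp.1 hpt (order_transform_eq_of_dvd hf hT hp.2) order_X_one
    tanY_X_one, ← one_add_one_eq_two]
  gcongr
  exact one_le_branchContact (hpt.irreducible_transform hp.1)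
    (tanY_X_one.order_transform_eq_one order_X_one)

/-- If v is tangent to x = 0, its contact with the transform is at most 1 and 1 + 1 ≤ d(C).
Otherwise v is, up to a unit, the transform of its contraction, and `contact_eq_add_one` applies. -/
theorem contact_transform_add_one_le {f v : Series K} (hf : TanY f) (hu : ¬ IsUnit f)
    (hT : (transform f).order = f.order) (h2 : 2 ≤ contactExponent f) (hv : v.order = 1) :
    contact (transform f) v + 1 ≤ contactExponent f := by
  by_cases h : cf v 0 1 = 0
  · obtain ⟨p, hp, hpf⟩ := exists_irreducible_dvd hf.1 hu
    have hpt := hf.of_dvd hpf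
    have hTp := order_transform_eq_of_dvd hf hT hpf
    obtain ⟨n, hn⟩ := exists_order_eq hpt.1
    have hirr := hpt.irreducible_transform hp
    have h3 : interNum (transform p) v ≤ (transform p).order := by
      rw [hTp, hn]
      exact interNum_le_of_vertical (hTp.trans hn)
        (ordY_eq_iff.1 (hpt.2.trans hn)).1 hv h
    have h1 : contact (transform f) v ≤ 1 :=
      (contact_le hv hirr (hf.transform_dvd hpf)).trans (branchContact_le_one hirr hv h3)
    refine le_trans ?_ h2
    rw [← one_add_one_eq_two]
    gcongr
  · have h1 : ordY v = 1 :=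
      le_antisymm (by exact_mod_cast ordY_le_of_cf h) (hv ▸ order_le_ordY v)
    obtain ⟨P, hP, hd, ha⟩ := exists_distinguished (n := 1) (by exact_mod_cast h1)
    have hw : (contract P).order = 1 := by rw [order_contract hP.monic, hd]; rfl
    have h4 := contact_eq_add_one hf hT hw hP.tanY_contract
    rw [transform_contract hP.monic] at h4
    have h5 : contact (transform f) v = contact (transform f) (ofPoly P) := by
      rw [contact_eq (irreducible_of_order_eq_one hv),
        contact_eq (irreducible_of_order_eq_one (order_eq_of_associated ha ▸ hv))]
      exact iInf_congr fun p => iInf_congr fun _ => branchContact_congr (Associated.refl p) ha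
    rw [h5, ← h4]
    exact contact_le_contactExponent f hw

theorem contactExponent_transform {f : Series K} (hf : TanY f) (hu : ¬ IsUnit f)
    (hT : (transform f).order = f.order) (h2 : 2 ≤ contactExponent f) :
    contactExponent (transform f) = contactExponent f - 1 := by
  apply le_antisymm
  · refine iSup₂_le fun v hv => ?_
    exact ENNReal.le_sub_of_add_le_right ENNReal.one_ne_top
      (contact_transform_add_one_le hf hu hT h2 hv.2)
  · rw [tsub_le_iff_right]
    refine iSup₂_le fun w hw => ?_
    by_cases hwt : TanY w
    · rw [contact_eq_add_one hf hT hw.2 hwt]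
      gcongr
      exact contact_le_contactExponent _ (hwt.order_transform_eq_one hw.2)
    · exact (contact_le_one hf hu hw.2 hwt).trans le_add_self

theorem tanY_of_hasMaximalContact {f w : Series K} (hf : TanY f) (hu : ¬ IsUnit f)
    (h2 : 2 ≤ contactExponent f) (hw : HasMaximalContact w f) : TanY w := by
  by_contra hwt
  have h1 := contact_le_one hf hu hw.1.2 hwt
  rw [hw.2] at h1
  exact absurd (h2.trans h1) (by norm_num)

theorem hasMaximalContact_transform {f w : Series K} (hf : TanY f) (hu : ¬ IsUnit f)
    (hT : (transform f).order = f.order) (h2 : 2 ≤ contactExponent f)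
    (hw : HasMaximalContact w f) : HasMaximalContact (transform w) (transform f) := by
  have hwt := tanY_of_hasMaximalContact hf hu h2 hw
  refine ⟨isSmoothBranch_iff.2 (hwt.order_transform_eq_one hw.1.2), ?_⟩
  rw [contactExponent_transform hf hu hT h2, ← hw.2, contact_eq_add_one hf hT hw.1.2 hwt]
  exact (ENNReal.add_sub_cancel_right ENNReal.one_ne_top).symm

/-! ### Invariance under automorphisms. -/

theorem interNum_map (σ : Series K ≃ₐ[K] Series K) (p q : Series K) :
    interNum (σ p) (σ q) = interNum p q := by
  have h : Ideal.span {σ p, σ q} = Ideal.map (σ : Series K →+* Series K) (Ideal.span {p, q}) := by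
    rw [Ideal.map_span, Set.image_pair]
    rfl
  rw [interNum, interNum]
  congr 1
  exact (Ideal.quotientEquivAlg _ _ σ h).toLinearEquiv.rank_eq.symm

theorem branchContact_map (σ : Series K ≃ₐ[K] Series K) (p q : Series K) :
    branchContact (σ p) (σ q) = branchContact p q := by
  rw [branchContact, branchContact, interNum_map, mult, mult, mult, mult, order_map_equiv,
    order_map_equiv]

theorem contact_map (σ : Series K ≃ₐ[K] Series K) (f g : Series K) :
    contact (σ f) (σ g) = contact f g := by
  have key : ∀ (σ : Series K ≃ₐ[K] Series K) (f g : Series K),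
      contact (σ f) (σ g) ≤ contact f g := by
    intro σ f g
    refine le_iInf₂ fun p hp => le_iInf₂ fun q hq => ?_
    rw [← branchContact_map σ]
    exact (iInf₂_le (σ p) ⟨(MulEquiv.irreducible_iff σ).2 hp.1, map_dvd σ hp.2⟩).trans
      (iInf₂_le (σ q) ⟨(MulEquiv.irreducible_iff σ).2 hq.1, map_dvd σ hq.2⟩)
  refine le_antisymm (key σ f g) ?_
  simpa using key σ.symm (σ f) (σ g)

theorem isSmoothBranch_map (σ : Series K ≃ₐ[K] Series K) {w : Series K} :
    IsSmoothBranch (σ w) ↔ IsSmoothBranch w := by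
  rw [isSmoothBranch_iff, isSmoothBranch_iff, order_map_equiv]

theorem contactExponent_map (σ : Series K ≃ₐ[K] Series K) (f : Series K) :
    contactExponent (σ f) = contactExponent f := by
  have key : ∀ (σ : Series K ≃ₐ[K] Series K) (f : Series K),
      contactExponent f ≤ contactExponent (σ f) := by
    intro σ f
    refine iSup₂_le fun w hw => ?_
    rw [← contact_map σ]
    exact contact_le_contactExponent _ ((isSmoothBranch_map σ).2 hw).2
  refine le_antisymm ?_ (key σ f)
  simpa using key σ.symm (σ f)

theorem hasMaximalContact_map (σ : Series K ≃ₐ[K] Series K) {w f : Series K} :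
    HasMaximalContact (σ w) (σ f) ↔ HasMaximalContact w f := by
  rw [HasMaximalContact, HasMaximalContact, isSmoothBranch_map, contact_map, contactExponent_map]

theorem isReducedCurve_iff {f : Series K} : IsReducedCurve f ↔ ¬ IsUnit f ∧ Squarefree f := by
  rw [IsReducedCurve, IsCurve, ← order_eq_zero_iff_isUnit, ← ne_eq f.order,
    MvPowerSeries.order_ne_zero_iff_constCoeff_eq_zero]
  exact ⟨fun h => ⟨h.1.2, h.2⟩, fun h => ⟨⟨h.2.ne_zero, h.1⟩, h.2⟩⟩

theorem squarefree_map (σ : Series K ≃ₐ[K] Series K) {f : Series K} (h : Squarefree f) :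
    Squarefree (σ f) := by
  intro x hx
  have h1 : σ.symm x * σ.symm x ∣ f := by
    rw [← map_mul, ← σ.symm_apply_apply f]
    exact map_dvd σ.symm hx
  simpa using (h _ h1).map σ

theorem isReducedCurve_map (σ : Series K ≃ₐ[K] Series K) {f : Series K} (h : IsReducedCurve f) :
    IsReducedCurve (σ f) := by
  rw [isReducedCurve_iff] at h ⊢
  exact ⟨by rw [MulEquiv.isUnit_map]; exact h.1, squarefree_map σ h.2⟩

/-! ### The strict transform in the two charts. -/

/-- The linear form vanishing on the line of slope `a`. -/
def slopeForm (a : K) : Series K :=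
  MvPowerSeries.X 1 - MvPowerSeries.C a * MvPowerSeries.X 0

theorem slopeForm_eq_contract (a : K) : slopeForm a =
    contract ((Polynomial.X - Polynomial.C a).map PowerSeries.C) := by
  have h : ofPoly (Polynomial.C (PowerSeries.C a)) = (MvPowerSeries.C a : Series K) := by
    apply iter.injective
    rw [iter_ofPoly, iter_C, Polynomial.coe_C]
  rw [Polynomial.map_sub, Polynomial.map_X, Polynomial.map_C, contract_X_sub_C, map_sub, map_mul,
    map_mul, ofPoly_X, ofPoly_C_X, h, slopeForm]

theorem contract_pow (P : Polynomial (PowerSeries K)) (n : ℕ) :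
    contract (P ^ n) = contract P ^ n := by
  induction n with
  | zero =>
    rw [pow_zero, pow_zero, contract, Polynomial.one_scaleRoots, map_one]
  | succ n ih => rw [pow_succ, pow_succ, contract_mul, ih]

/-- y - a x is the contraction of y - a, which turns powers of the linear form into powers of a
one-variable polynomial. -/
theorem cf_slopeForm_pow (a : K) (n i j : ℕ) : cf (slopeForm a ^ n) i j =
    if i + j = n then ((Polynomial.X - Polynomial.C a) ^ n).coeff j else 0 := by
  have hd : ((Polynomial.X - Polynomial.C a) ^ n).natDegree = n := by
    rw [Polynomial.natDegree_pow, Polynomial.natDegree_X_sub_C, mul_one]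
  rw [slopeForm_eq_contract, ← contract_pow, ← Polynomial.map_pow, cf_contract,
    Polynomial.natDegree_map, hd, Polynomial.coeff_map, PowerSeries.coeff_C]
  rcases le_or_gt j n with h | h
  · split_ifs <;> first | rfl | omega
  · rw [Polynomial.coeff_eq_zero_of_natDegree_lt (by omega)]
    simp

theorem hasTangent_slopeForm_iff {f : Series K} {n : ℕ} (hn : f.order = n) (a : K) :
    HasTangent f (slopeForm a) ↔ ∃ c : K, c ≠ 0 ∧
      ∀ i j, i + j = n → cf f i j = c * ((Polynomial.X - Polynomial.C a) ^ n).coeff j := by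
  constructor
  · rintro ⟨m, hm, c, hc, h⟩
    obtain rfl : n = m := by
      rw [hn] at hm
      exact_mod_cast hm
    refine ⟨c, hc, fun i j hij => ?_⟩
    have := le_order_iff.1 h i j (by omega)
    rwa [cf_sub, cf_C_mul, cf_slopeForm_pow, if_pos hij, sub_eq_zero] at this
  · rintro ⟨c, hc, h⟩
    refine ⟨n, hn, c, hc, le_order_iff.2 fun i j hij => ?_⟩
    rw [cf_sub, cf_C_mul, cf_slopeForm_pow]
    rcases Nat.lt_succ_iff_lt_or_eq.1 hij with h' | h'
    · rw [le_order_iff.1 hn.ge _ _ h', if_neg (by omega)]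
      simp
    · rw [if_pos h', h i j h', sub_self]

theorem coe_initialForm {f : Series K} {n : ℕ} (hn : f.order = n) :
    (initialForm f : Series K) = homPart f n := by
  rw [initialForm, homPart, hn, ENat.toNat_natCast]
  rw [← MvPolynomial.coeToMvPowerSeries.ringHom_apply, map_sum]
  refine Finset.sum_congr rfl fun i _ => ?_
  rw [← cf_eq_coeff, MvPolynomial.coeToMvPowerSeries.ringHom_apply, MvPolynomial.coe_monomial]
  apply ext_cf
  intro j k
  rw [cf_C_mul, cf_X_zero_pow_mul, cf_X_one_pow, cf_eq_coeff, MvPowerSeries.coeff_monomial]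
  have h : (Finsupp.single (0 : Fin 2) j + Finsupp.single 1 k =
      Finsupp.single 0 i + Finsupp.single 1 (n - i)) ↔ j = i ∧ k = n - i := by
    constructor
    · intro h
      exact ⟨by simpa using DFunLike.congr_fun h 0, by simpa using DFunLike.congr_fun h 1⟩
    · rintro ⟨rfl, rfl⟩
      rfl
  rw [if_congr h rfl rfl]
  split_ifs <;> first | omega | simp

theorem hasFiniteSlope_iff {f : Series K} (hf : f ≠ 0) (a : K) :
    HasFiniteSlope f a ↔ HasTangent f (slopeForm a) := by
  obtain ⟨n, hn⟩ := exists_order_eq hf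
  rw [hasTangent_slopeForm_iff hn, HasFiniteSlope]
  refine exists_congr fun c => and_congr_right fun _ => ?_
  rw [← MvPolynomial.coe_inj, coe_initialForm hn, hn, ENat.toNat_natCast]
  have : ((MvPolynomial.C c * (MvPolynomial.X 1 - MvPolynomial.C a * MvPolynomial.X 0) ^ n :
      MvPolynomial (Fin 2) K) : Series K) = MvPowerSeries.C c * slopeForm a ^ n := by
    simp only [slopeForm, ← MvPolynomial.coeToMvPowerSeries.ringHom_apply, map_mul, map_pow,
      map_sub]
    simp only [MvPolynomial.coeToMvPowerSeries.ringHom_apply, MvPolynomial.coe_C,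
      MvPolynomial.coe_X]
  rw [this]
  constructor
  · intro h i j hij
    have h1 := cf_homPart f n i j
    rw [h, cf_C_mul, cf_slopeForm_pow, if_pos hij, if_pos hij] at h1
    exact h1.symm
  · intro h
    apply ext_cf
    intro i j
    rw [cf_homPart, cf_C_mul, cf_slopeForm_pow]
    split_ifs with hij
    · exact h i j hij
    · simp

theorem shear_slopeForm (a : K) : shear a (slopeForm a) = MvPowerSeries.X 1 := by
  rw [shear_apply, slopeForm, map_sub, map_mul, shearHom_X_one, shearHom_X_zero, shearHom_C]
  ring

theorem hasTangent_slopeForm_iff_tanY {f : Series K} {a : K} :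
    HasTangent f (slopeForm a) ↔ TanY (shear a f) := by
  rw [← hasTangent_iff_tanY]
  constructor
  · intro h
    simpa [shear_slopeForm] using h.map (shear a)
  · intro h
    have := h.map (shear a).symm
    rwa [AlgEquiv.symm_apply_apply, ← shear_slopeForm a, AlgEquiv.symm_apply_apply] at this

theorem HasTangent.cf_ne_zero {f : Series K} {a : K} (h : HasTangent f (slopeForm a)) {n : ℕ}
    (hn : f.order = n) : cf f 0 n ≠ 0 := by
  obtain ⟨c, hc, h⟩ := (hasTangent_slopeForm_iff hn a).1 h
  rw [h 0 n (by omega)]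
  have := (Polynomial.monic_X_sub_C a).pow n
  have h1 := this.coeff_natDegree
  rw [Polynomial.natDegree_pow, Polynomial.natDegree_X_sub_C, mul_one] at h1
  rwa [h1, mul_one]

theorem form_eq_zero_of_slope {f : Series K} {a : K} (h : HasTangent f (slopeForm a)) {n : ℕ}
    (hn : f.order = n) (hn0 : 0 < n) : form f n 1 a = 0 := by
  rw [← cf_shear_zero hn.ge]
  exact ((tanY_iff_cf (n := n) (by rw [order_map_equiv, hn])).1
    (hasTangent_slopeForm_iff_tanY.1 h)).2 _ _ (by omega) hn0

/-- The homogeneous part of degree `n` of `f` on the line `x = 1`. -/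
def formPoly (f : Series K) (n : ℕ) : Polynomial K :=
  ∑ i ∈ Finset.range (n + 1), Polynomial.monomial (n - i) (cf f i (n - i))

theorem eval_formPoly (f : Series K) (n : ℕ) (a : K) : (formPoly f n).eval a = form f n 1 a := by
  rw [formPoly, form, Polynomial.eval_finsetSum]
  simp [Polynomial.eval_monomial]

theorem coeff_formPoly (f : Series K) {n i j : ℕ} (h : i + j = n) :
    (formPoly f n).coeff j = cf f i j := by
  simp only [formPoly, Polynomial.finsetSum_coeff, Polynomial.coeff_monomial]
  rw [Finset.sum_eq_single i]
  · rw [if_pos (by omega)]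
    congr 1; omega
  · intro k hk hki
    simp at hk
    rw [if_neg (by omega)]
  · intro hi
    simp at hi
    omega

theorem natDegree_formPoly_le (f : Series K) (n : ℕ) : (formPoly f n).natDegree ≤ n := by
  refine Polynomial.natDegree_sum_le_of_forall_le _ _ fun i _ => ?_
  exact (Polynomial.natDegree_monomial_le _).trans (Nat.sub_le _ _)

/-- On x = 1 the initial form is c (y - b)^n with n > 0, and a is a root of it. Uniqueness is needed
because `strictTransform` uses a chosen slope. -/
theorem eq_of_hasTangent {f : Series K} {a b : K} (ha : HasTangent f (slopeForm a))
    (hb : HasTangent f (slopeForm b)) (hf : ¬ IsUnit f) : a = b := by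
  obtain ⟨n, hn, -⟩ := id ha
  have hn0 : 0 < n := by
    rw [← order_eq_zero_iff_isUnit, hn] at hf
    exact Nat.pos_of_ne_zero (by exact_mod_cast hf)
  have h1 := form_eq_zero_of_slope ha hn hn0
  obtain ⟨c, hc, h⟩ := (hasTangent_slopeForm_iff hn b).1 hb
  have h2 : formPoly f n = Polynomial.C c * (Polynomial.X - Polynomial.C b) ^ n := by
    ext j
    rw [Polynomial.coeff_C_mul]
    rcases le_or_gt j n with hj | hj
    · rw [coeff_formPoly f (i := n - j) (by omega), h _ _ (by omega)]
    · rw [Polynomial.coeff_eq_zero_of_natDegree_lt ((natDegree_formPoly_le f n).trans_lt hj),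
        Polynomial.coeff_eq_zero_of_natDegree_lt (by
          rwa [Polynomial.natDegree_pow, Polynomial.natDegree_X_sub_C, mul_one]), mul_zero]
  rw [← eval_formPoly, h2] at h1
  simp only [Polynomial.eval_mul, Polynomial.eval_C, Polynomial.eval_pow, Polynomial.eval_sub,
    Polynomial.eval_X, mul_eq_zero, hc, false_or] at h1
  exact sub_eq_zero.1 (pow_eq_zero_iff (by omega) |>.1 h1)

/-- The substitution (x, ax + xy) is the shear y ↦ y + ax followed by y ↦ xy. -/
theorem strictTransform_of_slope {f : Series K} {a : K} (h : HasTangent f (slopeForm a))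
    (hf : ¬ IsUnit f) : strictTransform f = transform (shear a f) := by
  have hf0 : f ≠ 0 := by
    obtain ⟨n, hn, -⟩ := h
    exact ne_zero_of_order_eq hn
  have hex : ∃ a, HasFiniteSlope f a := ⟨a, (hasFiniteSlope_iff hf0 a).2 h⟩
  have hch : hex.choose = a :=
    eq_of_hasTangent ((hasFiniteSlope_iff hf0 _).1 hex.choose_spec) h hf
  rw [strictTransform, dif_pos hex, hch, transform, order_map_equiv, ← subst_eq_blow, shear_apply,
    shearHom_apply, MvPowerSeries.subst_comp_subst_apply (hasSubst_shear a)
      (hasSubst_of_fin_two (by simp) (by simp))]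
  congr 2
  have hb : ∀ g : Series K, MvPowerSeries.subst ![(MvPowerSeries.X 0 : Series K),
      MvPowerSeries.X 0 * MvPowerSeries.X 1] g = blow g := subst_eq_blow
  funext s
  rw [hb]
  fin_cases s
  · exact blow_X_zero.symm
  · change _ = blow (MvPowerSeries.X 1 + MvPowerSeries.C a * MvPowerSeries.X 0)
    rw [map_add, map_mul, blow_X_zero, blow_X_one, blow_C]
    exact add_comm _ _

theorem divPow_one_swap (n : ℕ) (g : Series K) : divPow 1 n (swap g) = swap (divPow 0 n g) := by
  apply ext_cf
  intro i j
  rw [cf_swap, cf_divPow_zero, ← cf_swap g, cf_eq_coeff, cf_eq_coeff]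
  change MvPowerSeries.coeff _ (swap g) = _
  congr 2
  ext k
  fin_cases k <;> simp

theorem swap_eq_subst (f : Series K) :
    swap f = MvPowerSeries.subst ![(MvPowerSeries.X 1 : Series K), MvPowerSeries.X 0] f := by
  refine (MvPowerSeries.rename_eq_subst (f := Equiv.swap (0 : Fin 2) 1) (p := f)).trans ?_
  congr 1
  funext s
  fin_cases s <;> simp

/-- The substitution (xy, y) is the chart (x, xy) conjugated by the exchange of variables. -/
theorem strictTransform_of_vertical {f : Series K} (h : ∀ a, ¬ HasTangent f (slopeForm a))
    (hf : f ≠ 0) : strictTransform f = swap (transform (swap f)) := by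
  have hex : ¬ ∃ a, HasFiniteSlope f a := fun ⟨a, ha⟩ => h a ((hasFiniteSlope_iff hf a).1 ha)
  have hs : MvPowerSeries.HasSubst ![(MvPowerSeries.X 1 : Series K), MvPowerSeries.X 0] :=
    hasSubst_of_fin_two (by simp) (by simp)
  have hs' : MvPowerSeries.HasSubst ![(MvPowerSeries.X 0 : Series K),
    MvPowerSeries.X 0 * MvPowerSeries.X 1] := hasSubst_of_fin_two (by simp) (by simp)
  rw [strictTransform, dif_neg hex, transform, order_map_equiv, ← divPow_one_swap]
  congr 1
  have h1 : (fun s => MvPowerSeries.subst ![(MvPowerSeries.X 0 : Series K),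
      MvPowerSeries.X 0 * MvPowerSeries.X 1] (![(MvPowerSeries.X 1 : Series K),
        MvPowerSeries.X 0] s)) =
      ![MvPowerSeries.X 0 * MvPowerSeries.X 1, MvPowerSeries.X 0] := by
    funext s
    rw [subst_eq_blow]
    fin_cases s
    · exact blow_X_one
    · exact blow_X_zero
  rw [swap_eq_subst f, ← subst_eq_blow, MvPowerSeries.subst_comp_subst_apply hs hs', h1,
    swap_eq_subst, MvPowerSeries.subst_comp_subst_apply
      (hasSubst_of_fin_two (by simp) (by simp)) hs]
  congr 1
  funext s
  rw [← swap_eq_subst]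
  fin_cases s
  · change _ = swap (MvPowerSeries.X 0 * MvPowerSeries.X 1)
    rw [map_mul, swap_X_zero, swap_X_one]
    exact mul_comm _ _
  · exact swap_X_zero.symm

theorem not_hasTangent_of_tanY_swap {f : Series K} (h : TanY (swap f)) (hf : ¬ IsUnit f) (a : K) :
    ¬ HasTangent f (slopeForm a) := by
  intro ha
  obtain ⟨n, hn, -⟩ := id ha
  have hn0 : 0 < n := by
    rw [← order_eq_zero_iff_isUnit, hn] at hf
    exact Nat.pos_of_ne_zero (by exact_mod_cast hf)
  have h1 := ((tanY_iff_cf (n := n) (by rw [order_map_equiv, hn])).1 h).2 n 0 rfl hn0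
  rw [cf_swap] at h1
  exact ha.cf_ne_zero hn h1

/-! ### The tangent cone and the choice of chart. -/

theorem mk_mem_cone {f : Series K} {n : ℕ} (hn : f.order = n) {v : Fin 2 → K} (hv : v ≠ 0) :
    Projectivization.mk K v hv ∈ cone f ↔ form f n (v 0) (v 1) = 0 := by
  have heval : ∀ u : Fin 2 → K, MvPolynomial.eval u (initialForm f) = form f n (u 0) (u 1) := by
    intro u
    rw [initialForm, map_sum, form, hn, ENat.toNat_natCast]
    refine Finset.sum_congr rfl fun i _ => ?_
    rw [MvPolynomial.eval_monomial, ← cf_eq_coeff, Finsupp.prod_fintype _ _ (by simp),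
      Fin.prod_univ_two]
    simp
  obtain ⟨t, ht⟩ := Projectivization.exists_smul_eq_mk_rep K v hv
  change MvPolynomial.eval _ (initialForm f) = 0 ↔ _
  rw [heval, ← ht]
  have : form f n ((t • v) 0) ((t • v) 1) = (t : K) ^ n * form f n (v 0) (v 1) := by
    rw [form, form, Finset.mul_sum]
    refine Finset.sum_congr rfl fun i hi => ?_
    have hi : i ≤ n := by simpa [Nat.lt_succ_iff] using hi
    rw [← Nat.add_sub_cancel' hi, pow_add, Nat.add_sub_cancel' hi]
    simp only [Pi.smul_apply, Units.smul_def, smul_eq_mul, mul_pow]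
    ring
  rw [this, mul_eq_zero, or_iff_right (pow_ne_zero _ t.ne_zero)]

/-- Restrict the initial form to x = 1. If (0:1) is the tangent, this polynomial has no root, hence
is constant and the form is c x^n. Otherwise it has degree n and a single root a, so it is c (y -
a)^n. -/
theorem exists_chart [IsAlgClosed K] {f : Series K} (h0 : f ≠ 0) (hf : ¬ IsUnit f)
    (h : IsUnitangent f) :
    (∃ a, HasTangent f (slopeForm a)) ∨ TanY (swap f) := by
  obtain ⟨n, hn⟩ := exists_order_eq h0
  have hn0 : 0 < n := by
    rw [← order_eq_zero_iff_isUnit, hn] at hf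
    exact Nat.pos_of_ne_zero (by exact_mod_cast hf)
  obtain ⟨P, hP⟩ := Set.encard_eq_one.1 h
  have hv : ∀ a : K, ![1, a] ≠ 0 := fun a h => one_ne_zero (congrFun h 0)
  have hcone : ∀ a, form f n 1 a = 0 ↔ Projectivization.mk K ![1, a] (hv a) = P := by
    intro a
    have := mk_mem_cone hn (hv a)
    rw [hP, Set.mem_singleton_iff] at this
    exact this.symm
  have hinj : ∀ a b, Projectivization.mk K ![1, a] (hv a) = Projectivization.mk K ![1, b] (hv b) →
      a = b := by
    intro a b hab
    rw [Projectivization.mk_eq_mk_iff'] at hab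
    obtain ⟨t, ht⟩ := hab
    have h0 := congrFun ht 0
    have h1 := congrFun ht 1
    simp at h0 h1
    rw [h0] at h1
    simpa using h1.symm
  by_cases hY : cf f 0 n = 0
  · right
    have hw : ![(0 : K), 1] ≠ 0 := fun h => one_ne_zero (congrFun h 1)
    have hmem : Projectivization.mk K ![0, 1] hw = P := by
      rw [← Set.mem_singleton_iff, ← hP, mk_mem_cone hn]
      simpa [form_zero_one] using hY
    have hno : ∀ a, form f n 1 a ≠ 0 := by
      intro a ha
      rw [hcone, ← hmem, Projectivization.mk_eq_mk_iff'] at ha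
      obtain ⟨t, ht⟩ := ha
      have := congrFun ht 0
      simp at this
    have hdeg : (formPoly f n).degree = 0 := by
      by_contra hd
      obtain ⟨a, ha⟩ := IsAlgClosed.exists_root _ hd
      exact hno a (by rwa [← eval_formPoly])
    have hc := Polynomial.eq_C_of_degree_eq_zero hdeg
    rw [tanY_iff_cf (n := n) (by rw [order_map_equiv, hn])]
    constructor
    · rw [cf_swap, ← coeff_formPoly f (n := n) (by omega)]
      intro h0
      rw [h0] at hc
      rw [hc] at hdeg
      simp at hdeg
    · intro i j hij hi
      rw [cf_swap, ← coeff_formPoly f (n := n) (by omega), hc, Polynomial.coeff_C,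
        if_neg (by omega)]
  · left
    have hd : (formPoly f n).natDegree = n := by
      refine le_antisymm (natDegree_formPoly_le f n) (Polynomial.le_natDegree_of_ne_zero ?_)
      rwa [coeff_formPoly f (i := 0) (by omega)]
    obtain ⟨a, ha⟩ := exists_form_eq_zero hn0 hY
    have hroots : (formPoly f n).roots = Multiset.replicate n a := by
      rw [Multiset.eq_replicate]
      constructor
      · exact (IsAlgClosed.splits (formPoly f n)).natDegree_eq_card_roots.symm.trans hd
      · intro b hb
        have hb' := Polynomial.isRoot_of_mem_roots hb
        rw [Polynomial.IsRoot.def, eval_formPoly, hcone] at hb'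
        exact hinj _ _ (hb'.trans ((hcone a).1 ha).symm)
    have hfac := (IsAlgClosed.splits (formPoly f n)).eq_prod_roots
    rw [hroots, Multiset.map_replicate, Multiset.prod_replicate] at hfac
    have hlead : (formPoly f n).leadingCoeff ≠ 0 := by
      rw [Polynomial.leadingCoeff, hd, coeff_formPoly f (i := 0) (by omega)]
      exact hY
    refine ⟨a, (hasTangent_slopeForm_iff hn a).2 ⟨_, hlead, fun i j hij => ?_⟩⟩
    rw [← coeff_formPoly f hij, ← Polynomial.coeff_C_mul]
    conv_lhs => rw [hfac]

/-! ### Assembly of the theorem. -/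

/-- Treats both charts at once: σ moves the tangent to y = 0 and τ is applied after the transform.
For a finite slope σ is a shear and τ the identity; for the vertical tangent both are the exchange
of variables. -/
theorem main_of_chart [IsAlgClosed K] {f : Series K} (σ τ : Series K ≃ₐ[K] Series K)
    (hred : IsReducedCurve f) (hf : TanY (σ f))
    (hs : strictTransform f = τ (transform (σ f)))
    (hsw : ∀ w : Series K, w.order = 1 → TanY (σ w) → strictTransform w = τ (transform (σ w)))
    (hcone : ∀ w : Series K, w.order = 1 → cone w = cone f → TanY (σ w)) :
    IsReducedCurve (strictTransform f) ∧
    (contactExponent f < 2 → mult (strictTransform f) < mult f) ∧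
    (2 ≤ contactExponent f →
      mult (strictTransform f) = mult f ∧
      contactExponent (strictTransform f) = contactExponent f - 1) ∧
    (2 ≤ contactExponent f → ∀ w : Series K, IsSmoothBranch w →
      (cone w = cone f → contact f w = contact (strictTransform f) (strictTransform w) + 1) ∧
      (HasMaximalContact w f → HasMaximalContact (strictTransform w) (strictTransform f))) := by
  have hred' := isReducedCurve_iff.1 (isReducedCurve_map σ hred)
  have hT : 2 ≤ contactExponent f → (transform (σ f)).order = (σ f).order := fun h2 =>
    order_transform_eq_of_two_le hf (by rwa [contactExponent_map])
  rw [hs]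
  refine ⟨isReducedCurve_map τ (isReducedCurve_iff.2
    ⟨fun hu => hred'.1 (hf.isUnit_of_transform hu), hf.squarefree_transform hred'.2⟩), ?_, ?_, ?_⟩
  · intro h2
    rw [mult, mult, order_map_equiv, ← order_map_equiv σ f]
    refine lt_of_le_of_ne hf.order_transform_le fun heq => ?_
    have := two_le_contactExponent hf heq
    rw [contactExponent_map] at this
    exact absurd this (not_le.2 h2)
  · intro h2
    refine ⟨?_, ?_⟩
    · rw [mult, mult, order_map_equiv, hT h2, order_map_equiv]
    · rw [contactExponent_map, contactExponent_transform hf hred'.1 (hT h2)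
        (by rwa [contactExponent_map]), contactExponent_map]
  · intro h2 w hw
    have hσw : (σ w).order = 1 := by rw [order_map_equiv]; exact hw.2
    have h2' : 2 ≤ contactExponent (σ f) := by rwa [contactExponent_map]
    refine ⟨fun hc => ?_, fun hm => ?_⟩
    · have hwt := hcone w hw.2 hc
      rw [hsw w hw.2 hwt, contact_map, ← contact_map σ f w]
      exact contact_eq_add_one hf (hT h2) hσw hwt
    · have hm' := (hasMaximalContact_map σ).2 hm
      -- Maximal contact forces tangency, so w is transformed in the same chart as f.
      have hwt := tanY_of_hasMaximalContact hf hred'.1 h2' hm'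
      rw [hsw w hw.2 hwt, hasMaximalContact_map]
      exact hasMaximalContact_transform hf hred'.1 (hT h2) h2' hm'

theorem not_isUnit_of_order_eq_one {w : Series K} (hw : w.order = 1) : ¬ IsUnit w :=
  (irreducible_of_order_eq_one hw).not_isUnit

end PlaneCurve

end


theorem mainTheorem4 {K : Type*} [Field K] [IsAlgClosed K] (f : PlaneCurve.Series K)
    (hred : PlaneCurve.IsReducedCurve f)
    (hsing : 1 < PlaneCurve.mult f)
    (htan : PlaneCurve.IsUnitangent f) :
    PlaneCurve.IsReducedCurve (PlaneCurve.strictTransform f) ∧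
    (PlaneCurve.contactExponent f < 2 →
      PlaneCurve.mult (PlaneCurve.strictTransform f) < PlaneCurve.mult f) ∧
    (2 ≤ PlaneCurve.contactExponent f →
      PlaneCurve.mult (PlaneCurve.strictTransform f) = PlaneCurve.mult f ∧
      PlaneCurve.contactExponent (PlaneCurve.strictTransform f) =
        PlaneCurve.contactExponent f - 1) ∧
    (2 ≤ PlaneCurve.contactExponent f →
      ∀ w : PlaneCurve.Series K, PlaneCurve.IsSmoothBranch w →
        (PlaneCurve.cone w = PlaneCurve.cone f →
          PlaneCurve.contact f w =
            PlaneCurve.contact (PlaneCurve.strictTransform f)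
              (PlaneCurve.strictTransform w) + 1) ∧
        (PlaneCurve.HasMaximalContact w f →
          PlaneCurve.HasMaximalContact (PlaneCurve.strictTransform w)
            (PlaneCurve.strictTransform f))) := by
  open PlaneCurve in
  have hf0 : f ≠ 0 := hred.1.1
  have hu : ¬ IsUnit f := (isReducedCurve_iff.1 hred).1
  obtain ⟨n, hn⟩ := exists_order_eq hf0
  have hn0 : 0 < n := by
    rw [mult, hn] at hsing
    have : 1 < n := by exact_mod_cast hsing
    omega
  rcases exists_chart hf0 hu htan with ⟨a, ha⟩ | ha
  · refine main_of_chart (shear a) AlgEquiv.refl hred (hasTangent_slopeForm_iff_tanY.1 ha)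
      (strictTransform_of_slope ha hu) (fun w hw hwt => strictTransform_of_slope
        (hasTangent_slopeForm_iff_tanY.2 hwt) (not_isUnit_of_order_eq_one hw)) ?_
    intro w hw hc
    have hw' : w.order = (1 : ℕ) := by exact_mod_cast hw
    have hv : ![1, a] ≠ 0 := fun h => one_ne_zero (congrFun h 0)
    have hv' : ![(0 : K), 1] ≠ 0 := fun h => one_ne_zero (congrFun h 1)
    -- Two points determine the linear part of w: (1:a) lies on the common cone and (0:1) does not.
    have h1 := (mk_mem_cone hn hv).2 (by simpa using form_eq_zero_of_slope ha hn hn0)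
    have h2 := (mk_mem_cone hn hv').not.2 (by simpa [form_zero_one] using ha.cf_ne_zero hn)
    rw [← hc, mk_mem_cone hw'] at h1 h2
    rw [tanY_iff_cf (n := 1) (by rw [order_map_equiv, hw'])]
    refine ⟨?_, fun i j hij hi => ?_⟩
    · rw [cf_zero_shear hw'.ge]
      simpa [form_zero_one] using h2
    · obtain ⟨rfl, rfl⟩ : i = 1 ∧ j = 0 := by omega
      rw [cf_shear_zero hw'.ge]
      simpa using h1
  · refine main_of_chart swap swap hred ha
      (strictTransform_of_vertical (not_hasTangent_of_tanY_swap ha hu) hf0)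
      (fun w hw hwt => strictTransform_of_vertical
        (not_hasTangent_of_tanY_swap hwt (not_isUnit_of_order_eq_one hw))
        (irreducible_of_order_eq_one hw).ne_zero) ?_
    intro w hw hc
    have hw' : w.order = (1 : ℕ) := by exact_mod_cast hw
    have hv' : ![(0 : K), 1] ≠ 0 := fun h => one_ne_zero (congrFun h 1)
    have h0 := ((tanY_iff_cf (n := n) (by rw [order_map_equiv, hn])).1 ha).2 n 0 rfl hn0
    rw [cf_swap] at h0
    -- Here (0:1) lies on the common cone, so w has no y-term and therefore has an x-term.
    have h1 := (mk_mem_cone hn hv').2 (by simpa [form_zero_one] using h0)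
    rw [← hc, mk_mem_cone hw'] at h1
    have h2 : cf w 0 1 = 0 := by simpa [form_zero_one] using h1
    rw [tanY_iff_cf (n := 1) (by rw [order_map_equiv, hw'])]
    refine ⟨?_, fun i j hij hi => ?_⟩
    · rw [cf_swap]
      obtain ⟨i, hi, hi'⟩ := exists_cf_ne_zero hw'
      rcases Nat.le_one_iff_eq_zero_or_eq_one.1 hi with rfl | rfl
      · exact absurd h2 hi'
      · exact hi'
    · obtain ⟨rfl, rfl⟩ : i = 1 ∧ j = 0 := by omega
      rw [cf_swap]
      exact h2
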